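/- For $\zeta>0$ let $K_\nu(\zeta)=\int_0^\infty\cosh(\nu\vartheta)\,e^{-\zeta\cosh\vartheta}\,d\vartheta$. For $\ell=0,1$ put $$\omega^{(\ell)}(x;\zeta)=\frac{(x^2-1)^{\ell-1/2}}{K_1(\zeta)}e^{-\zeta x}\quad(x>1),\qquad (f,g)_{\omega^{(\ell)}}=\int_1^\infty f(x)g(x)\,\omega^{(\ell)}(x;\zeta)\,dx .$$ Let $P_n^{(\ell)}(x;\zeta)$ ($n=0,1,2,\dots$) be the orthonormal polynomials for this inner product, with $\deg P_n^{(\ell)}=n$ and leading coefficient $c_n^{(\ell)}>0$. Let $\sigma_n^{(\ell)}$ denote the sum of the zeros of $P_n^{(\ell)}$ and put $$a_k^{(\ell)}=(xP_k^{(\ell)},P_{k+1}^{(\ell)})_{\omega^{(\ell)}},\quad b_k^{(\ell)}=(xP_k^{(\ell)},P_k^{(\ell)})_{\omega^{(\ell)}},$$ $$p_k=\frac{c_k^{(0)}}{c_k^{(1)}},\quad q_k=\frac{c_k^{(1)}}{c_{k+1}^{(0)}}\bigl(\sigma_{k+2}^{(0)}-\sigma_k^{(1)}\bigr),\quad r_k=\frac{c_{k-1}^{(1)}}{c_{k+1}^{(0)}}\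 (k\ge1).$$ Let $J_n^{(\ell)}$ be the symmetric tridiagonal $(n+1)\times(n+1)$ matrix with diagonal $b_0^{(\ell)},\dots,b_n^{(\ell)}$ and off-diagonal $a_0^{(\ell)},\dots,a_{n-1}^{(\ell)}$. Let $J_{n-1}$ be the $n\times(n+1)$ matrix whose row $k$ ($k=0,\dots,n-1$) has the entries $p_k,q_k,r_{k+1}$ in columns $k,k+1,k+2$ (columns are numbered from $0$ to $n$, and $r_n$ is omitted in the last row) and zeros elsewhere. For $n\ge0$ define the $(2n+1)\times(2n+1)$ matrices $$A_n^0=\begin{pmatrix}J_n^{(0)}&0\\0&J_{n-1}^{(1)}\end{pmatrix},\qquad A_n^1=\begin{pmatrix}0&J_{n-1}^T\\J_{n-1}&0\end{pmatrix}.$$ A generalized eigenvalue of the pair is a number $\hat\lambda$ such that $A_n^1y=\hat\lambda A_n^0y$ for some $y\ne0$; it is simple if it is a simple root of $\det(XA_n^0-A_n^1)$. Finally let $$Q_{2n}(x;\zeta)=P_{n+1}^{(0)}(x;\zeta)P_n^{(1)}(-x;\zeta)+P_{n+1}^{(0)}(-x;\zeta)P_n^{(1)}(x;\zeta).$$ **Theorem.**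 Let $n\ge 0$ and $\zeta>0$. The polynomial $Q_{2n}(\cdot;\zeta)$ is even of degree $2n$ and has exactly $2n$ zeros, which are real and simple. Labelled in increasing order by $i=-n,\dots,-1,1,\dots,n$, these zeros $z_{i,n}=z_{i,n}(\zeta)$ satisfy $z_{-i,n}=-z_{i,n}$, and $z_{i,n}>1$ for $i=1,\dots,n$. Put $$\hat\lambda_{i,n}=\frac{\sqrt{z_{i,n}^2-1}}{z_{i,n}},\qquad i=\pm1,\dots,\pm n .$$ Then the complex generalized eigenvalues of the pair $(A_n^0,A_n^1)$ are exactly $\hat\lambda_{0,n}=0$ and the $2n$ numbers $\hat\lambda_{i,n}$. The latter are pairwise distinct, real and non-zero with $|\hat\lambda_{i,n}|<1$, and all $2n+1$ generalized eigenvalues are simple. The functions $\zeta\mapsto\hat\lambda_{i,n}$ are differentiable, with $$\frac{\partial\hat\lambda_{i,n}}{\partial\zeta}<0\ (i=1,\dots,n),\qquad \frac{\partial\hat\lambda_{i,n}}{\partial\zeta}>0\ (i=-n,\dots,-1).$$ With $\vec P_m^{(\ell)}=(P_0^{(\ell)},\dots,P_m^{(\ell)})^T$, the eigenvectors are, up to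 scalar factors, the non-zero vectors $y_{i,n}=(u_{i,n}^T,v_{i,n}^T)^T$, where for $i=\pm1,\dots,\pm n$ and $z=z_{i,n}$ $$u_{i,n}=\vec P_n^{(0)}(z;\zeta)P_n^{(1)}(-z;\zeta)+\vec P_n^{(0)}(-z;\zeta)P_n^{(1)}(z;\zeta),$$ $$v_{i,n}=\sqrt{z^2-1}\,\bigl(\vec P_{n-1}^{(1)}(z;\zeta)P_n^{(1)}(-z;\zeta)-\vec P_{n-1}^{(1)}(-z;\zeta)P_n^{(1)}(z;\zeta)\bigr),$$ and $$u_{0,n}=\vec P_n^{(0)}(1;\zeta)P_{n+1}^{(0)}(-1;\zeta)-\vec P_n^{(0)}(-1;\zeta)P_{n+1}^{(0)}(1;\zeta),\qquad v_{0,n}=0 .$$ -/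

import Mathlib

open Polynomial

noncomputable section

namespace RelOP

/-- Modified Bessel function of the second kind,
`K_ν(ζ) = ∫_0^∞ cosh(ν θ) exp(-ζ cosh θ) dθ`. -/
def besselK (ν ζ : ℝ) : ℝ :=
  ∫ θ in Set.Ioi (0 : ℝ), Real.cosh (ν * θ) * Real.exp (-ζ * Real.cosh θ)

/-- The weight `ω^(ℓ)(x; ζ) = (x² - 1)^(ℓ - 1/2) exp(-ζ x) / K_1(ζ)`. -/
def weight (l : ℕ) (ζ x : ℝ) : ℝ :=
  (x ^ 2 - 1) ^ ((l : ℝ) - 1 / 2) / besselK 1 ζ * Real.exp (-ζ * x)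

/-- The weighted inner product `(f, g)_{ω^(ℓ)} = ∫_1^∞ f g ω^(ℓ) dx` of two polynomials. -/
def ip (l : ℕ) (ζ : ℝ) (f g : ℝ[X]) : ℝ :=
  ∫ x in Set.Ioi (1 : ℝ), f.eval x * g.eval x * weight l ζ x

/-- The monic orthogonal polynomials for `ω^(ℓ)`, by Gram-Schmidt applied to `1, X, X², …`. -/
def monicOP (l : ℕ) (ζ : ℝ) (n : ℕ) : ℝ[X] :=
  X ^ n - ∑ k : Fin n,
    C (ip l ζ (X ^ n) (monicOP l ζ k) / ip l ζ (monicOP l ζ k) (monicOP l ζ k)) * monicOP l ζ k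
termination_by n
decreasing_by exact k.isLt

/-- The orthonormal polynomials `P_n^(ℓ)(x; ζ)` with positive leading coefficient. -/
def P (l : ℕ) (ζ : ℝ) (n : ℕ) : ℝ[X] :=
  C (Real.sqrt (ip l ζ (monicOP l ζ n) (monicOP l ζ n)))⁻¹ * monicOP l ζ n

/-- Leading coefficient `c_n^(ℓ)` of `P_n^(ℓ)`. -/
def lc (l : ℕ) (ζ : ℝ) (n : ℕ) : ℝ := (P l ζ n).leadingCoeff

/-- Sum of the zeros of `P_n^(ℓ)`. -/
def zeroSum (l : ℕ) (ζ : ℝ) (n : ℕ) : ℝ := (P l ζ n).roots.sum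

/-- `a_n^(ℓ) = (x P_n^(ℓ), P_{n+1}^(ℓ))`. -/
def aCoef (l : ℕ) (ζ : ℝ) (n : ℕ) : ℝ := ip l ζ (X * P l ζ n) (P l ζ (n + 1))

/-- `b_n^(ℓ) = (x P_n^(ℓ), P_n^(ℓ))`. -/
def bCoef (l : ℕ) (ζ : ℝ) (n : ℕ) : ℝ := ip l ζ (X * P l ζ n) (P l ζ n)

/-- `p_n = c_n^(0) / c_n^(1)`. -/
def pCoef (ζ : ℝ) (n : ℕ) : ℝ := lc 0 ζ n / lc 1 ζ n

/-- `q_n = (c_n^(1) / c_{n+1}^(0)) (∑ zeros of P_{n+2}^(0) - ∑ zeros of P_n^(1))`. -/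
def qCoef (ζ : ℝ) (n : ℕ) : ℝ :=
  lc 1 ζ n / lc 0 ζ (n + 1) * (zeroSum 0 ζ (n + 2) - zeroSum 1 ζ n)

/-- `r_n = c_{n-1}^(1) / c_{n+1}^(0)`; only used for `n ≥ 1`. -/
def rCoef (ζ : ℝ) (n : ℕ) : ℝ := lc 1 ζ (n - 1) / lc 0 ζ (n + 1)

/-- The symmetric tridiagonal Jacobi matrix of size `m × m` with diagonal `b_0, …, b_{m-1}` and
off-diagonal `a_0, …, a_{m-2}`, i.e. `J_{m-1}^(ℓ)` when matrices are indexed by their last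
row number (indexed by their size here, so that the empty matrix is included). -/
def jacobi (l : ℕ) (ζ : ℝ) (m : ℕ) : Matrix (Fin m) (Fin m) ℝ :=
  Matrix.of fun i j =>
    if i = j then bCoef l ζ i
    else if (j : ℕ) = i + 1 then aCoef l ζ i
    else if (i : ℕ) = j + 1 then aCoef l ζ j
    else 0

/-- The `m × (m+1)` upper triangular banded matrix `J_{m-1}`, whose `i`-th row carries
`p_i, q_i, r_{i+1}` in columns `i, i+1, i+2` (the entry `r_m` of the last row is cut off). -/
def mixed (ζ : ℝ) (m : ℕ) : Matrix (Fin m) (Fin (m + 1)) ℝ :=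
  Matrix.of fun i j =>
    if (j : ℕ) = i then pCoef ζ i
    else if (j : ℕ) = i + 1 then qCoef ζ i
    else if (j : ℕ) = i + 2 then rCoef ζ (i + 1)
    else 0

/-- `A⁰_n = diag(J_n^(0), J_{n-1}^(1))`. -/
def A0 (ζ : ℝ) (n : ℕ) : Matrix (Fin (n + 1) ⊕ Fin n) (Fin (n + 1) ⊕ Fin n) ℝ :=
  Matrix.fromBlocks (jacobi 0 ζ (n + 1)) 0 0 (jacobi 1 ζ n)

/-- `A¹_n`, with off-diagonal blocks `J_{n-1}ᵀ` and `J_{n-1}`. -/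
def A1 (ζ : ℝ) (n : ℕ) : Matrix (Fin (n + 1) ⊕ Fin n) (Fin (n + 1) ⊕ Fin n) ℝ :=
  Matrix.fromBlocks 0 (mixed ζ n).transpose (mixed ζ n) 0

/-- `μ` is a generalized eigenvalue of the pair `(A, B)`: `B y = μ A y` for some `y ≠ 0`. -/
def IsGenEigenvalue {K ι : Type*} [Field K] [Fintype ι] (A B : Matrix ι ι K) (μ : K) : Prop :=
  ∃ y : ι → K, y ≠ 0 ∧ B.mulVec y = μ • A.mulVec y

/-- The polynomial `det(X A - B)`, whose root multiplicities are the algebraic multiplicities of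
the generalized eigenvalues of the pair `(A, B)`. -/
def pencilPoly {K ι : Type*} [Field K] [Fintype ι] [DecidableEq ι] (A B : Matrix ι ι K) : K[X] :=
  ((X : K[X]) • A.map (C : K →+* K[X]) - B.map (C : K →+* K[X])).det

/-- `Q_{2n}(x) = P_{n+1}^(0)(x) P_n^(1)(-x) + P_{n+1}^(0)(-x) P_n^(1)(x)`. -/
def Q (ζ : ℝ) (n : ℕ) : ℝ[X] :=
  P 0 ζ (n + 1) * (P 1 ζ n).comp (-X) + (P 0 ζ (n + 1)).comp (-X) * P 1 ζ n

/-- The index set `{±1, …, ±n}`. -/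
def idx (n : ℕ) : Set ℤ := {i | i ≠ 0 ∧ |i| ≤ (n : ℤ)}

/-- `λ̂ = √(z² - 1) / z`. -/
def lamHat (z : ℝ) : ℝ := Real.sqrt (z ^ 2 - 1) / z

/-- The vector `(P_0^(ℓ)(x), …, P_{m-1}^(ℓ)(x))` of length `m`. -/
def Pvec (l : ℕ) (ζ : ℝ) (m : ℕ) (x : ℝ) : Fin m → ℝ := fun k => (P l ζ k).eval x

/-- `P_n^(0)vec(z) P_n^(1)(-z) + P_n^(0)vec(-z) P_n^(1)(z)`. -/
def uVec (ζ : ℝ) (n : ℕ) (z : ℝ) : Fin (n + 1) → ℝ :=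
  (P 1 ζ n).eval (-z) • Pvec 0 ζ (n + 1) z + (P 1 ζ n).eval z • Pvec 0 ζ (n + 1) (-z)

/-- `√(z² - 1) (P_{n-1}^(1)vec(z) P_n^(1)(-z) - P_{n-1}^(1)vec(-z) P_n^(1)(z))`. -/
def vVec (ζ : ℝ) (n : ℕ) (z : ℝ) : Fin n → ℝ :=
  Real.sqrt (z ^ 2 - 1) •
    ((P 1 ζ n).eval (-z) • Pvec 1 ζ n z - (P 1 ζ n).eval z • Pvec 1 ζ n (-z))

/-- The eigenvector `y = (u, v)` attached to a zero `z` of `Q_{2n}`. -/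
def yVec (ζ : ℝ) (n : ℕ) (z : ℝ) : Fin (n + 1) ⊕ Fin n → ℝ :=
  Sum.elim (uVec ζ n z) (vVec ζ n z)

/-- The eigenvector for the eigenvalue `0`:
`u = P_n^(0)vec(1) P_{n+1}^(0)(-1) - P_n^(0)vec(-1) P_{n+1}^(0)(1)`, `v = 0`. -/
def yZero (ζ : ℝ) (n : ℕ) : Fin (n + 1) ⊕ Fin n → ℝ :=
  Sum.elim
    ((P 0 ζ (n + 1)).eval (-1) • Pvec 0 ζ (n + 1) 1 -
      (P 0 ζ (n + 1)).eval 1 • Pvec 0 ζ (n + 1) (-1))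
    0

end RelOP

end

open RelOP

/-!
Let `π_k` and `ρ_k` be the monic orthogonal polynomials of the two weights. The second weight is
`x² - 1` times the first, so Christoffel's relation reads
`(x² - 1) ρ_n = α π_n + (x + δ) π_{n+1}`, and up to a constant factor

  `(x² - 1) Q(x) = π_{n+1}(x) π_{n+1}(-x) (R(x) - R(1))`,
  where `R(x) = π_n(x) / π_{n+1}(x) + π_n(-x) / π_{n+1}(-x)`.

The sign of `Q` alternates along the `n + 1` zeros of `π_{n+1}`, which lie in `(1, ∞)`; this gives
`n` zeros beyond `1`, and evenness together with the degree bound `2n` leaves room for no others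
than these and their negatives. Since `π_n / π_{n+1}` has partial fractions with positive residues,
`R` has negative derivative at every zero `z > 1`. In the parameter `ζ` the weight is multiplied by
an exponential, so `S = π_n / π_{n+1}` satisfies the Riccati equation of the Toda flow,
`∂S/∂ζ = (x - b) S - 1 - a S²` with `a > 0`, and `R(z) - R(1)` decreases in `ζ`. By the implicit
function theorem the positive zeros decrease.

On vectors of orthonormal polynomials the blocks of `A0` act as multiplication by `x`, and those of
`A1` as multiplication by `x² - 1` and by `1`, up to a multiple of the first polynomial cut off.
The vectors `u` and `v` combine the values at `z` and `-z` so that these remainders cancel when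
`Q(z) = 0`. As `A0` is block diagonal with Gram matrices as blocks it is invertible, and the
`2n + 1` distinct eigenvalues so obtained exhaust the roots of `det (X A0 - A1)`.
-/

namespace RelOP

/-! ### Monic orthogonal polynomials of a linear functional -/

/-- The monic orthogonal polynomials of a linear functional `L`: `π n` is monic of degree `n` and
`L (π n * q) = 0` for every `q` of smaller degree. The functional plays the role of integration
against a weight. -/
structure IsMonicOrthogonal {R : Type*} [CommRing R] (L : R[X] →ₗ[R] R) (π : ℕ → R[X]) :
    Prop where
  monic : ∀ n, (π n).Monic
  natDegree_eq : ∀ n, (π n).natDegree = n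
  apply_mul_eq_zero : ∀ (n : ℕ) (q : R[X]), q.degree < n → L (π n * q) = 0

theorem degree_sub_C_coeff_mul_lt {R : Type*} [Ring R] {p q : R[X]} {n : ℕ} (hp : p.Monic)
    (hpn : p.natDegree = n) (hq : q.degree < ((n + 1 : ℕ) : WithBot ℕ)) :
    (q - C (q.coeff n) * p).degree < n := by
  rw [degree_lt_iff_coeff_zero] at hq ⊢
  intro k hk
  rw [coeff_sub, coeff_C_mul]
  rcases hk.eq_or_lt with rfl | hk
  · rw [← hpn, hp.coeff_natDegree, mul_one, sub_self]
  · rw [hq k hk, coeff_eq_zero_of_natDegree_lt (hpn.trans_lt hk), mul_zero, sub_zero]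

theorem degree_sum_C_mul_lt {R : Type*} [Ring R] {π : ℕ → R[X]} {m : ℕ} (c : ℕ → R)
    (hπ : ∀ k < m, (π k).degree < m) :
    (∑ k ∈ Finset.range m, C (c k) * π k).degree < m := by
  refine mem_degreeLT.1 (Submodule.sum_mem _ fun k hk => ?_)
  rw [← smul_eq_C_mul]
  exact Submodule.smul_mem _ _ (mem_degreeLT.2 (hπ k (Finset.mem_range.1 hk)))

theorem apply_sum_C_mul_mul {R : Type*} [CommRing R] {L : R[X] →ₗ[R] R} {π : ℕ → R[X]} {n k : ℕ}
    (c : ℕ → R) (hk : k < n) (hπ : ∀ j < n, j ≠ k → L (π j * π k) = 0) :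
    L ((∑ j ∈ Finset.range n, C (c j) * π j) * π k) = c k * L (π k * π k) := by
  have hterm j : L (C (c j) * π j * π k) = c j * L (π j * π k) := by
    rw [mul_assoc, ← smul_eq_C_mul, map_smul, smul_eq_mul]
  rw [Finset.sum_mul, map_sum, Finset.sum_eq_single_of_mem k (Finset.mem_range.2 hk), hterm]
  intro j hj hjk
  rw [hterm, hπ j (Finset.mem_range.1 hj) hjk, mul_zero]

theorem degree_X_mul_lt_succ {R : Type*} [Semiring R] {q : R[X]} {n : ℕ} (hq : q.degree < n) :
    (X * q).degree < ((n + 1 : ℕ) : WithBot ℕ) := by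
  rw [degree_lt_iff_coeff_zero] at hq ⊢
  rintro (_ | m) hm
  · simp at hm
  · rw [coeff_X_mul]
    exact hq m (by omega)

theorem natDegree_X_mul_le {R : Type*} [Semiring R] {q : R[X]} {n : ℕ} (hq : q.natDegree ≤ n) :
    (X * q).natDegree ≤ n + 1 :=
  (natDegree_mul_le_of_le natDegree_X_le hq).trans_eq (add_comm 1 n)

theorem degree_lt_succ_of_natDegree_le {R : Type*} [Semiring R] {q : R[X]} {n : ℕ}
    (hq : q.natDegree ≤ n) : q.degree < ((n + 1 : ℕ) : WithBot ℕ) :=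
  (degree_le_of_natDegree_le hq).trans_lt (by exact_mod_cast n.lt_succ_self)

namespace IsMonicOrthogonal

section CommRing

variable {R : Type*} [CommRing R] {L : R[X] →ₗ[R] R} {π : ℕ → R[X]}

theorem coeff_self (h : IsMonicOrthogonal L π) (n : ℕ) : (π n).coeff n = 1 := by
  simpa only [h.natDegree_eq] using (h.monic n).coeff_natDegree

theorem degree_lt (h : IsMonicOrthogonal L π) {k n : ℕ} (hkn : k < n) : (π k).degree < n :=
  degree_le_natDegree.trans_lt (by rw [h.natDegree_eq]; exact_mod_cast hkn)

theorem apply_mul_of_ne (h : IsMonicOrthogonal L π) {i j : ℕ} (hij : i ≠ j) :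
    L (π i * π j) = 0 := by
  rcases lt_or_gt_of_ne hij with hlt | hlt
  · rw [mul_comm]
    exact h.apply_mul_eq_zero j _ (h.degree_lt hlt)
  · exact h.apply_mul_eq_zero i _ (h.degree_lt hlt)

theorem zero_eq_one (h : IsMonicOrthogonal L π) : π 0 = 1 :=
  (h.monic 0).natDegree_eq_zero.1 (h.natDegree_eq 0)

theorem one_eq_X_sub_C (h : IsMonicOrthogonal L π) : ∃ b : R, π 1 = X - C b :=
  ⟨-(π 1).coeff 0, by simpa using (h.monic 1).eq_X_add_C (h.natDegree_eq 1)⟩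

theorem apply_mul (h : IsMonicOrthogonal L π) {n : ℕ} {q : R[X]} (hq : q.natDegree ≤ n) :
    L (π n * q) = q.coeff n * L (π n * π n) := by
  have h0 := h.apply_mul_eq_zero n _
    (degree_sub_C_coeff_mul_lt (h.monic n) (h.natDegree_eq n) (degree_lt_succ_of_natDegree_le hq))
  rwa [mul_sub, map_sub, mul_left_comm, ← smul_eq_C_mul, map_smul, smul_eq_mul, sub_eq_zero] at h0

theorem apply_X_mul_mul_eq_zero (h : IsMonicOrthogonal L π) (n : ℕ) {q : R[X]}
    (hq : q.degree < n) : L (X * π (n + 1) * q) = 0 := by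
  rw [mul_comm X, mul_assoc]
  exact h.apply_mul_eq_zero _ _ (degree_X_mul_lt_succ hq)

theorem apply_X_mul_mul_succ (h : IsMonicOrthogonal L π) (n : ℕ) :
    L (X * π n * π (n + 1)) = L (π (n + 1) * π (n + 1)) := by
  rw [mul_comm, h.apply_mul (natDegree_X_mul_le (h.natDegree_eq n).le), coeff_X_mul,
    h.coeff_self, one_mul]

end CommRing

section Field

variable {K : Type*} [Field K] {L : K[X] →ₗ[K] K} {π : ℕ → K[X]}

theorem eq_zero_of_apply_mul_eq_zero (h : IsMonicOrthogonal L π)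
    (hL : ∀ n, L (π n * π n) ≠ 0) {m : ℕ} {f : K[X]} (hf : f.degree < m)
    (hz : ∀ k < m, L (f * π k) = 0) : f = 0 := by
  by_contra hne
  rw [degree_eq_natDegree hne, Nat.cast_lt] at hf
  have h0 := hz _ hf
  rw [mul_comm, h.apply_mul le_rfl] at h0
  exact mul_ne_zero (leadingCoeff_ne_zero.2 hne) (hL _) h0

theorem eq_sum (h : IsMonicOrthogonal L π) (hL : ∀ n, L (π n * π n) ≠ 0) {m : ℕ} {f : K[X]}
    (hf : f.degree < m) :
    f = ∑ k ∈ Finset.range m, C (L (f * π k) / L (π k * π k)) * π k := by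
  refine sub_eq_zero.1 (h.eq_zero_of_apply_mul_eq_zero hL (m := m) ?_ fun j hj => ?_)
  · exact (degree_sub_le _ _).trans_lt
      (max_lt hf (degree_sum_C_mul_lt _ fun k => h.degree_lt))
  · rw [sub_mul, map_sub, apply_sum_C_mul_mul _ hj fun i _ hij => h.apply_mul_of_ne hij,
      div_mul_cancel₀ _ (hL j), sub_self]

theorem eq_sum_of_apply_mul_eq_zero (h : IsMonicOrthogonal L π) (hL : ∀ n, L (π n * π n) ≠ 0)
    {m : ℕ} {f : K[X]} (hf : f.natDegree ≤ m + 2)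
    (ho : ∀ q : K[X], q.degree < m → L (f * q) = 0) :
    f = C (f.coeff (m + 2)) * π (m + 2)
      + C (L (f * π (m + 1)) / L (π (m + 1) * π (m + 1))) * π (m + 1)
      + C (L (f * π m) / L (π m * π m)) * π m := by
  have htop : L (f * π (m + 2)) / L (π (m + 2) * π (m + 2)) = f.coeff (m + 2) := by
    rw [mul_comm, h.apply_mul hf, mul_div_cancel_right₀ _ (hL _)]
  have hlow : ∀ k ∈ Finset.range m, C (L (f * π k) / L (π k * π k)) * π k = 0 := fun k hk => by
    rw [ho _ (h.degree_lt (Finset.mem_range.1 hk)), zero_div, C_0, zero_mul]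
  conv_lhs => rw [h.eq_sum hL (degree_lt_succ_of_natDegree_le hf)]
  rw [Finset.sum_range_succ, Finset.sum_range_succ, Finset.sum_range_succ,
    Finset.sum_eq_zero hlow, htop]
  ring

theorem eq_X_pow_sub_sum (h : IsMonicOrthogonal L π) (hL : ∀ n, L (π n * π n) ≠ 0) (n : ℕ) :
    π n = X ^ n - ∑ k ∈ Finset.range n, C (L (X ^ n * π k) / L (π k * π k)) * π k := by
  have hlt : (X ^ n - π n).degree < (n : WithBot ℕ) := by
    simpa using degree_sub_C_coeff_mul_lt (h.monic n) (h.natDegree_eq n)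
      (degree_lt_succ_of_natDegree_le (natDegree_X_pow_le n))
  rw [eq_sub_iff_add_eq, ← eq_sub_iff_add_eq', h.eq_sum hL hlt]
  refine Finset.sum_congr rfl fun k hk => ?_
  rw [sub_mul, map_sub, h.apply_mul_of_ne (Finset.mem_range.1 hk).ne', sub_zero]

theorem recurrence (h : IsMonicOrthogonal L π) (hL : ∀ n, L (π n * π n) ≠ 0) (n : ℕ) :
    ∃ b : K, π (n + 2) = (X - C b) * π (n + 1)
      - C (L (π (n + 1) * π (n + 1)) / L (π n * π n)) * π n := by
  have key := h.eq_sum_of_apply_mul_eq_zero hL (m := n)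
    (natDegree_X_mul_le (h.natDegree_eq (n + 1)).le) fun q => h.apply_X_mul_mul_eq_zero n
  rw [coeff_X_mul, h.coeff_self, show X * π (n + 1) * π n = X * π n * π (n + 1) by ring,
    h.apply_X_mul_mul_succ, C_1, one_mul] at key
  exact ⟨L (X * π (n + 1) * π (n + 1)) / L (π (n + 1) * π (n + 1)), by linear_combination -key⟩

end Field

end IsMonicOrthogonal

theorem monic_and_natDegree_eq_of_eq_X_pow_sub_sum {R : Type*} [CommRing R] [Nontrivial R]
    {π : ℕ → R[X]} {c : ℕ → ℕ → R}
    (hπ : ∀ n, π n = X ^ n - ∑ k ∈ Finset.range n, C (c n k) * π k) (n : ℕ) :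
    (π n).Monic ∧ (π n).natDegree = n := by
  induction n using Nat.strong_induction_on with
  | _ n ih =>
    have hlt : (∑ k ∈ Finset.range n, C (c n k) * π k).degree < n :=
      degree_sum_C_mul_lt _ fun k hk => degree_le_natDegree.trans_lt
        (by rw [(ih k hk).2]; exact_mod_cast hk)
    rw [hπ n]
    refine ⟨monic_X_pow_sub hlt, natDegree_eq_of_degree_eq_some ?_⟩
    rw [degree_sub_eq_left_of_degree_lt (by rwa [degree_X_pow]), degree_X_pow]

theorem apply_mul_eq_zero_of_forall_lt {R : Type*} [CommRing R] {L : R[X] →ₗ[R] R}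
    {π : ℕ → R[X]} {n : ℕ} (hmonic : ∀ k < n, (π k).Monic) (hdeg : ∀ k < n, (π k).natDegree = k)
    {f : R[X]} (hf : ∀ k < n, L (f * π k) = 0) {q : R[X]} (hq : q.degree < n) :
    L (f * q) = 0 := by
  induction n generalizing q with
  | zero =>
    rw [degree_eq_bot.1 (Nat.WithBot.lt_zero_iff.1 hq), mul_zero, map_zero]
  | succ n ih =>
    have h0 := ih (fun k hk => hmonic k (hk.trans n.lt_succ_self))
      (fun k hk => hdeg k (hk.trans n.lt_succ_self)) (fun k hk => hf k (hk.trans n.lt_succ_self))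
      (degree_sub_C_coeff_mul_lt (hmonic n n.lt_succ_self) (hdeg n n.lt_succ_self) hq)
    rwa [mul_sub, map_sub, mul_left_comm, ← smul_eq_C_mul, map_smul, hf n n.lt_succ_self,
      smul_zero, sub_zero] at h0

theorem isMonicOrthogonal_of_eq_X_pow_sub_sum {K : Type*} [Field K] {L : K[X] →ₗ[K] K}
    {π : ℕ → K[X]} (hL : ∀ n, L (π n * π n) ≠ 0)
    (hπ : ∀ n, π n = X ^ n - ∑ k ∈ Finset.range n, C (L (X ^ n * π k) / L (π k * π k)) * π k) :
    IsMonicOrthogonal L π := by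
  have hmonic n := (monic_and_natDegree_eq_of_eq_X_pow_sub_sum hπ n).1
  have hdeg n := (monic_and_natDegree_eq_of_eq_X_pow_sub_sum hπ n).2
  suffices horth : ∀ n, ∀ k < n, L (π n * π k) = 0 from ⟨hmonic, hdeg, fun n q hq =>
    apply_mul_eq_zero_of_forall_lt (fun k _ => hmonic k) (fun k _ => hdeg k) (horth n) hq⟩
  intro n
  induction n using Nat.strong_induction_on with
  | _ n ih =>
    intro k hk
    rw [hπ n, sub_mul, map_sub, apply_sum_C_mul_mul _ hk, div_mul_cancel₀ _ (hL k), sub_self]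
    intro j hj hjk
    rcases lt_or_gt_of_ne hjk with hlt | hlt
    · rw [mul_comm]
      exact ih k hk j hlt
    · exact ih j hj k hlt

/-! ### Positivity and zeros -/

/-- Positivity of a linear functional on `S`, as for integration against a measure on `S` with
infinite support: nonzero polynomials which are nonnegative on `S` have a positive value. -/
def IsPositiveOn (L : ℝ[X] →ₗ[ℝ] ℝ) (S : Set ℝ) : Prop :=
  ∀ p : ℝ[X], p ≠ 0 → (∀ x ∈ S, 0 ≤ p.eval x) → 0 < L p

variable {L : ℝ[X] →ₗ[ℝ] ℝ} {S : Set ℝ} {π : ℕ → ℝ[X]}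

namespace IsPositiveOn

theorem apply_mul_self_pos (hL : IsPositiveOn L S) {p : ℝ[X]} (hp : p ≠ 0) : 0 < L (p * p) :=
  hL _ (mul_ne_zero hp hp) fun x _ => by rw [eval_mul]; exact mul_self_nonneg _

theorem comp_mulLeft (hL : IsPositiveOn L S) {q : ℝ[X]} (hq : q ≠ 0)
    (hqS : ∀ x ∈ S, 0 ≤ q.eval x) : IsPositiveOn (L ∘ₗ LinearMap.mulLeft ℝ q) S :=
  fun p hp hpS => hL _ (mul_ne_zero hq hp) fun x hx => by
    rw [LinearMap.mulLeft_apply, eval_mul]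
    exact mul_nonneg (hqS x hx) (hpS x hx)

theorem smul (hL : IsPositiveOn L S) {c : ℝ} (hc : 0 < c) : IsPositiveOn (c • L) S :=
  fun p hp hpS => mul_pos hc (hL p hp hpS)

theorem det_gram_ne_zero (hL : IsPositiveOn L S) {ι : Type*} [Fintype ι] [DecidableEq ι]
    {v : ι → ℝ[X]} (hv : LinearIndependent ℝ v) :
    (Matrix.of fun i j => L (v i * v j)).det ≠ 0 := by
  intro hdet
  obtain ⟨y, hy, hker⟩ := Matrix.exists_mulVec_eq_zero_iff.2 hdet
  have hsum : ∑ j, y j • v j = 0 := by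
    by_contra hne
    refine (hL.apply_mul_self_pos hne).ne' ?_
    rw [Finset.sum_mul, map_sum]
    refine Finset.sum_eq_zero fun i _ => ?_
    have hrow : ∑ j, L (v i * v j) * y j = 0 := congrFun hker i
    rw [smul_mul_assoc, map_smul, Finset.mul_sum, map_sum]
    simp only [mul_smul_comm, map_smul, smul_eq_mul]
    simp only [mul_comm (y _), hrow, zero_mul]
  exact hy (funext (Fintype.linearIndependent_iff.1 hv y hsum))

end IsPositiveOn

namespace IsMonicOrthogonal

theorem apply_mul_self_pos (h : IsMonicOrthogonal L π) (hL : IsPositiveOn L S) (n : ℕ) :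
    0 < L (π n * π n) :=
  hL.apply_mul_self_pos (h.monic n).ne_zero

theorem apply_mul_self_ne_zero (h : IsMonicOrthogonal L π) (hL : IsPositiveOn L S) (n : ℕ) :
    L (π n * π n) ≠ 0 :=
  (h.apply_mul_self_pos hL n).ne'

theorem not_dvd_of_nonneg (h : IsMonicOrthogonal L π) (hL : IsPositiveOn L S) {n : ℕ} {q : ℝ[X]}
    (hq : 0 < q.natDegree) (hqS : ∀ x ∈ S, 0 ≤ q.eval x) : ¬ q ∣ π n := by
  rintro ⟨g, hg⟩
  have hq0 : q ≠ 0 := ne_zero_of_natDegree_gt hq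
  have hg0 : g ≠ 0 := right_ne_zero_of_mul (hg ▸ (h.monic n).ne_zero)
  have hdeg : g.degree < n := by
    have hn := h.natDegree_eq n
    rw [hg, natDegree_mul hq0 hg0] at hn
    rw [degree_eq_natDegree hg0, Nat.cast_lt]
    omega
  have hpos : 0 < L (q * (g * g)) :=
    (hL.comp_mulLeft hq0 hqS).apply_mul_self_pos hg0
  rw [← mul_assoc, ← hg, h.apply_mul_eq_zero n g hdeg] at hpos
  exact hpos.false

theorem lt_of_eval_eq_zero {a : ℝ} (h : IsMonicOrthogonal L π)
    (hL : IsPositiveOn L (Set.Ici a)) {n : ℕ} {r : ℝ} (hr : (π n).eval r = 0) : a < r := by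
  by_contra! hra
  refine h.not_dvd_of_nonneg hL (q := X - C r) ?_ (fun x hx => ?_) (dvd_iff_isRoot.2 hr)
  · rw [natDegree_X_sub_C]
    exact one_pos
  · simpa using hra.trans hx

theorem eval_ne_zero_of_le {a : ℝ} (h : IsMonicOrthogonal L π)
    (hL : IsPositiveOn L (Set.Ici a)) (n : ℕ) {x : ℝ} (hx : x ≤ a) : (π n).eval x ≠ 0 :=
  fun h0 => hx.not_gt (h.lt_of_eval_eq_zero hL h0)

theorem nodup_roots (h : IsMonicOrthogonal L π) (hL : IsPositiveOn L S) (n : ℕ) :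
    (π n).roots.Nodup := by
  rw [Multiset.nodup_iff_count_le_one]
  intro r
  rw [count_roots]
  by_contra! hlt
  have hdvd : (X - C r) ^ 2 ∣ π n :=
    (pow_dvd_pow _ hlt).trans (pow_rootMultiplicity_dvd (π n) r)
  refine h.not_dvd_of_nonneg hL ?_ (fun x _ => ?_) hdvd
  · rw [natDegree_pow, natDegree_X_sub_C]
    exact two_pos
  · simpa using sq_nonneg (x - r)

theorem splits (h : IsMonicOrthogonal L π) (hL : IsPositiveOn L S) (n : ℕ) : (π n).Splits := by
  refine Splits.of_splits_map_of_injective (i := algebraMap ℝ ℂ) (algebraMap ℝ ℂ).injective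
    (IsAlgClosed.splits _) fun z hz => ?_
  have hz0 : aeval z (π n) = 0 := by
    rw [aeval_def, ← eval_map]
    exact (mem_roots'.1 hz).2
  by_contra hreal
  have him : z.im ≠ 0 := fun him => hreal ⟨z.re, Complex.ext rfl him.symm⟩
  refine h.not_dvd_of_nonneg hL ?_ (fun x _ => ?_)
    (quadratic_dvd_of_aeval_eq_zero_im_ne_zero _ hz0 him)
  · have hdeg : (X ^ 2 - C (2 * z.re) * X + C (‖z‖ ^ 2) : ℝ[X]).natDegree = 2 := by
      compute_degree!
    rw [hdeg]
    exact two_pos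
  · simp only [eval_add, eval_sub, eval_mul, eval_pow, eval_X, eval_C]
    rw [← Complex.normSq_eq_norm_sq, Complex.normSq_apply]
    nlinarith [mul_self_nonneg (x - z.re), mul_self_nonneg z.im]

theorem eq_nodal (h : IsMonicOrthogonal L π) (hL : IsPositiveOn L S) (n : ℕ) :
    π n = Lagrange.nodal (π n).roots.toFinset id := by
  rw [Lagrange.nodal_eq]
  conv_lhs => rw [(h.splits hL n).eq_prod_roots_of_monic (h.monic n)]
  rw [Finset.prod, Multiset.toFinset_val, (h.nodup_roots hL n).dedup]
  rfl

theorem card_roots_toFinset (h : IsMonicOrthogonal L π) (hL : IsPositiveOn L S) (n : ℕ) :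
    (π n).roots.toFinset.card = n := by
  rw [Multiset.toFinset_card_of_nodup (h.nodup_roots hL n),
    ← (h.splits hL n).natDegree_eq_card_roots, h.natDegree_eq]

theorem abs_eval_lt_abs_eval {a : ℝ} (h : IsMonicOrthogonal L π)
    (hL : IsPositiveOn L (Set.Ici a)) {n : ℕ} (hn : 0 < n) {x y : ℝ} (hxy : x < y) (hy : y ≤ a) :
    |(π n).eval y| < |(π n).eval x| := by
  have hlt {r : ℝ} (hr : r ∈ (π n).roots.toFinset) : y < r :=
    hy.trans_lt (h.lt_of_eval_eq_zero hL (mem_roots'.1 (Multiset.mem_toFinset.1 hr)).2)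
  rw [h.eq_nodal hL, Lagrange.eval_nodal, Lagrange.eval_nodal, Finset.abs_prod, Finset.abs_prod]
  refine Finset.prod_lt_prod_of_nonempty (fun r hr => abs_pos.2 (sub_neg.2 (hlt hr)).ne)
    (fun r hr => ?_) (Finset.card_pos.1 (by rwa [h.card_roots_toFinset hL]))
  rw [id, abs_of_neg (sub_neg.2 (hlt hr)), abs_of_neg (sub_neg.2 (hxy.trans (hlt hr)))]
  linarith

theorem wronskian_pos (h : IsMonicOrthogonal L π) (hL : IsPositiveOn L S) (n : ℕ) (x : ℝ) :
    0 < (derivative (π (n + 1))).eval x * (π n).eval x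
      - (π (n + 1)).eval x * (derivative (π n)).eval x := by
  induction n with
  | zero =>
    obtain ⟨b, hb⟩ := h.one_eq_X_sub_C
    simp [hb, h.zero_eq_one]
  | succ n ih =>
    obtain ⟨b, hb⟩ := h.recurrence (h.apply_mul_self_ne_zero hL) n
    have ha : 0 < L (π (n + 1) * π (n + 1)) / L (π n * π n) :=
      div_pos (h.apply_mul_self_pos hL _) (h.apply_mul_self_pos hL _)
    set a := L (π (n + 1) * π (n + 1)) / L (π n * π n)
    rw [hb]
    simp only [derivative_sub, derivative_mul, derivative_X, derivative_C, eval_sub, eval_mul,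
      eval_add, eval_X, eval_C, eval_one, eval_zero]
    nlinarith [mul_pos ha ih, mul_self_nonneg ((π (n + 1)).eval x)]

end IsMonicOrthogonal

/-! ### Even cross sums and the Christoffel relation -/

theorem coeff_comp_neg_X {R : Type*} [CommRing R] (p : R[X]) (k : ℕ) :
    (p.comp (-X)).coeff k = p.coeff k * (-1) ^ k := by
  rw [← comp_C_mul_X_coeff, C_neg, C_1, neg_one_mul]

theorem coeff_eq_zero_of_comp_neg_X {R : Type*} [CommRing R] [IsAddTorsionFree R] {p : R[X]}
    (hp : p.comp (-X) = p) {k : ℕ} (hk : Odd k) : p.coeff k = 0 := by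
  have h := coeff_comp_neg_X p k
  rwa [hp, hk.neg_one_pow, mul_neg_one, self_eq_neg] at h

/-- The even polynomial `f(x) g(-x) + f(-x) g(x)`; the polynomial `Q_{2n}` is of this form. -/
noncomputable def crossSum {R : Type*} [CommRing R] (f g : R[X]) : R[X] :=
  f * g.comp (-X) + f.comp (-X) * g

variable {ρ : ℕ → ℝ[X]}

section CommRing

variable {R : Type*} [CommRing R] {f g : R[X]}

theorem eval_crossSum (f g : R[X]) (x : R) :
    (crossSum f g).eval x = f.eval x * g.eval (-x) + f.eval (-x) * g.eval x := by
  simp only [crossSum, eval_add, eval_mul, eval_comp, eval_neg, eval_X]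

theorem crossSum_comp_neg_X (f g : R[X]) : (crossSum f g).comp (-X) = crossSum f g := by
  simp only [crossSum, add_comp, mul_comp, comp_neg_X_comp_neg_X]
  ring

theorem crossSum_C_mul_C_mul (a b : R) (f g : R[X]) :
    crossSum (C a * f) (C b * g) = C (a * b) * crossSum f g := by
  simp only [crossSum, mul_comp, C_comp, C_mul]
  ring

theorem natDegree_crossSum_le [IsAddTorsionFree R] {n : ℕ} (hf : f.natDegree ≤ n + 1)
    (hg : g.natDegree ≤ n) :
    (crossSum f g).natDegree ≤ 2 * n := by
  have hcomp (p : R[X]) : (p.comp (-X)).natDegree = p.natDegree :=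
    natDegree_eq_natDegree degree_comp_neg_X
  have hle : (crossSum f g).natDegree ≤ n + 1 + n :=
    natDegree_add_le_of_degree_le (natDegree_mul_le_of_le hf ((hcomp g).trans_le hg))
      (natDegree_mul_le_of_le ((hcomp f).trans_le hf) hg)
  refine natDegree_le_iff_coeff_eq_zero.2 fun k hk => ?_
  rcases (show 2 * n + 1 ≤ k from hk).eq_or_lt with rfl | hk
  · exact coeff_eq_zero_of_comp_neg_X (crossSum_comp_neg_X f g) (odd_two_mul_add_one n)
  · exact coeff_eq_zero_of_natDegree_lt (by omega)

end CommRing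

/-- Twice the even part of the rational function `f / g`, namely `f(x)/g(x) + f(-x)/g(-x)`. -/
noncomputable def evenRatio (f g : ℝ[X]) (x : ℝ) : ℝ :=
  f.eval x / g.eval x + f.eval (-x) / g.eval (-x)

namespace IsMonicOrthogonal

theorem exists_christoffel (h : IsMonicOrthogonal L π) (hL : IsPositiveOn L (Set.Ici 1))
    (hρ : IsMonicOrthogonal (L ∘ₗ LinearMap.mulLeft ℝ (X ^ 2 - 1)) ρ) (n : ℕ) :
    ∃ α δ : ℝ, α ≠ 0 ∧
      (X ^ 2 - 1) * ρ n = C α * π n + (X + C δ) * π (n + 1) := by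
  have hne := h.apply_mul_self_ne_zero hL
  have hsq : (X ^ 2 - 1 : ℝ[X]).Monic := monic_X_pow_sub_C 1 two_ne_zero
  have hmonic : ((X ^ 2 - 1) * ρ n).Monic := hsq.mul (hρ.monic n)
  have hdeg : ((X ^ 2 - 1) * ρ n).natDegree = n + 2 := by
    rw [hsq.natDegree_mul (hρ.monic n), hρ.natDegree_eq, add_comm, add_left_cancel_iff]
    exact natDegree_X_pow_sub_C
  have hexp := h.eq_sum_of_apply_mul_eq_zero hne hdeg.le fun q hq => by
    rw [mul_assoc]
    exact hρ.apply_mul_eq_zero n q hq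
  obtain ⟨b, hb⟩ := h.recurrence hne n
  rw [← hdeg, hmonic.coeff_natDegree, hdeg, hb, C_1, one_mul] at hexp
  set e := L ((X ^ 2 - 1) * ρ n * π (n + 1)) / L (π (n + 1) * π (n + 1))
  set f := L ((X ^ 2 - 1) * ρ n * π n) / L (π n * π n)
  set a := L (π (n + 1) * π (n + 1)) / L (π n * π n)
  have hrel : (X ^ 2 - 1) * ρ n = C (f - a) * π n + (X + C (e - b)) * π (n + 1) := by
    rw [hexp, C_sub, C_sub]
    ring
  refine ⟨f - a, e - b, fun hα => ?_, hrel⟩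
  -- otherwise both `1` and `-1` are roots of `X + C δ`
  have hroot {x : ℝ} (hx : x ^ 2 = 1) (hx1 : x ≤ 1) : x + (e - b) = 0 := by
    have hev := congrArg (eval x) hrel
    simp only [hα, C_0, zero_mul, zero_add, eval_mul, eval_sub, eval_pow, eval_X, eval_one, hx,
      sub_self, eval_add, eval_C] at hev
    exact (mul_eq_zero.1 hev.symm).resolve_right fun h0 =>
      hx1.not_gt (h.lt_of_eval_eq_zero hL h0)
  linarith [hroot (one_pow 2) le_rfl, hroot neg_one_sq (by norm_num)]

theorem exists_eval_crossSum (h : IsMonicOrthogonal L π) (hL : IsPositiveOn L (Set.Ici 1))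
    (hρ : IsMonicOrthogonal (L ∘ₗ LinearMap.mulLeft ℝ (X ^ 2 - 1)) ρ) (n : ℕ) :
    ∃ α : ℝ, α ≠ 0 ∧ ∀ x, (π (n + 1)).eval x ≠ 0 → (π (n + 1)).eval (-x) ≠ 0 →
      (x ^ 2 - 1) * (crossSum (π (n + 1)) (ρ n)).eval x
        = α * ((π (n + 1)).eval x * (π (n + 1)).eval (-x))
          * (evenRatio (π n) (π (n + 1)) x - evenRatio (π n) (π (n + 1)) 1) := by
  obtain ⟨α, δ, hα, hrel⟩ := h.exists_christoffel hL hρ n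
  have heval (x : ℝ) : (x ^ 2 - 1) * (ρ n).eval x
      = α * (π n).eval x + (x + δ) * (π (n + 1)).eval x := by
    simpa using congrArg (eval x) hrel
  have hone : α * evenRatio (π n) (π (n + 1)) 1 = -(2 * δ) := by
    have hpos := h.eval_ne_zero_of_le hL (n + 1) le_rfl
    have hneg := h.eval_ne_zero_of_le hL (n + 1) (show (-1 : ℝ) ≤ 1 by norm_num)
    rw [evenRatio]
    field_simp
    linear_combination -(π (n + 1)).eval (-1) * heval 1 - (π (n + 1)).eval 1 * heval (-1)
  refine ⟨α, hα, fun x hx hx' => ?_⟩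
  have hratio : α * ((π (n + 1)).eval x * (π (n + 1)).eval (-x)) * evenRatio (π n) (π (n + 1)) x
      = α * ((π n).eval x * (π (n + 1)).eval (-x) + (π n).eval (-x) * (π (n + 1)).eval x) := by
    rw [evenRatio]
    field_simp
  rw [mul_sub, hratio, eval_crossSum]
  linear_combination (π (n + 1)).eval x * heval (-x) + (π (n + 1)).eval (-x) * heval x
    + (π (n + 1)).eval x * (π (n + 1)).eval (-x) * hone

theorem eval_ne_zero_of_eval_succ_eq_zero (h : IsMonicOrthogonal L π) (hL : IsPositiveOn L S)
    {n : ℕ} {x : ℝ} (hx : (π (n + 1)).eval x = 0) : (π n).eval x ≠ 0 := fun h0 => by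
  simpa [hx, h0] using h.wronskian_pos hL n x

theorem eval_ne_zero_of_eval_crossSum_eq_zero (h : IsMonicOrthogonal L π)
    (hL : IsPositiveOn L (Set.Ici 1))
    (hρ : IsMonicOrthogonal (L ∘ₗ LinearMap.mulLeft ℝ (X ^ 2 - 1)) ρ) {n : ℕ} {x : ℝ}
    (hx : -1 ≤ x) (hroot : (crossSum (π (n + 1)) (ρ n)).eval x = 0) :
    (π (n + 1)).eval x ≠ 0 := fun h0 => by
  obtain ⟨α, δ, hα, hrel⟩ := h.exists_christoffel hL hρ n
  rw [eval_crossSum, h0, zero_mul, zero_add] at hroot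
  have hρ0 : (ρ n).eval x = 0 := (mul_eq_zero.1 hroot).resolve_left
    (h.eval_ne_zero_of_le hL _ (by linarith))
  have heval := congrArg (eval x) hrel
  simp only [eval_mul, eval_add, hρ0, h0, mul_zero, add_zero, eval_C] at heval
  exact mul_ne_zero hα (h.eval_ne_zero_of_eval_succ_eq_zero hL h0) heval.symm

end IsMonicOrthogonal

/-! ### Partial fractions and interlacing -/

theorem eval_div_eval_nodal {s : Finset ℝ} {f : ℝ[X]} (hf : f.degree < s.card) {x : ℝ}
    (hx : x ∉ s) :
    f.eval x / (Lagrange.nodal s id).eval x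
      = ∑ ξ ∈ s, Lagrange.nodalWeight s id ξ * f.eval ξ / (x - ξ) := by
  have hx' : ∀ ξ ∈ s, x ≠ id ξ := fun ξ hξ h => hx (h ▸ hξ)
  rw [div_eq_iff (Lagrange.eval_nodal_not_at_node hx'), mul_comm]
  conv_lhs => rw [Lagrange.eq_interpolate (v := id) (Set.injOn_id _) hf,
    Lagrange.eval_interpolate_not_at_node _ hx']
  congr 1
  exact Finset.sum_congr rfl fun ξ _ => by rw [id, div_eq_mul_inv]; ring

theorem IsMonicOrthogonal.exists_partialFractions (h : IsMonicOrthogonal L π)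
    (hL : IsPositiveOn L S) (n : ℕ) :
    ∃ m : ℝ → ℝ, (∀ ξ ∈ (π (n + 1)).roots.toFinset, 0 < m ξ) ∧
      ∀ x ∉ (π (n + 1)).roots.toFinset,
        (π n).eval x / (π (n + 1)).eval x
          = ∑ ξ ∈ (π (n + 1)).roots.toFinset, m ξ / (x - ξ) := by
  set s := (π (n + 1)).roots.toFinset
  have hnodal : π (n + 1) = Lagrange.nodal s id := h.eq_nodal hL (n + 1)
  have hcard : (π n).degree < s.card := by
    rw [h.card_roots_toFinset hL]
    exact h.degree_lt n.lt_succ_self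
  refine ⟨fun ξ => Lagrange.nodalWeight s id ξ * (π n).eval ξ, fun ξ hξ => ?_, fun x hx => ?_⟩
  · change 0 < Lagrange.nodalWeight s id ξ * (π n).eval ξ
    have hroot : (π (n + 1)).eval ξ = 0 := (mem_roots'.1 (Multiset.mem_toFinset.1 hξ)).2
    have hw := h.wronskian_pos hL n ξ
    rw [hroot, zero_mul, sub_zero] at hw
    rw [Lagrange.nodalWeight_eq_eval_derivative_nodal hξ, ← hnodal, inv_mul_eq_div]
    exact div_pos_iff.2 ((mul_pos_iff.1 hw).imp And.symm And.symm)
  · rw [hnodal]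
    exact eval_div_eval_nodal hcard hx

theorem eval_nodal_mul_pos {s : Finset ℝ} {x y : ℝ}
    (h : ∀ ξ ∈ s, ξ < x ∧ ξ < y ∨ x < ξ ∧ y < ξ) :
    0 < (Lagrange.nodal s id).eval x * (Lagrange.nodal s id).eval y := by
  rw [Lagrange.eval_nodal, Lagrange.eval_nodal, ← Finset.prod_mul_distrib]
  refine Finset.prod_pos fun ξ hξ => ?_
  rcases h ξ hξ with ⟨hx, hy⟩ | ⟨hx, hy⟩
  · exact mul_pos (sub_pos.2 hx) (sub_pos.2 hy)
  · exact mul_pos_of_neg_of_neg (sub_neg.2 hx) (sub_neg.2 hy)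

theorem derivative_nodal_mul_neg {s : Finset ℝ} {a b : ℝ} (ha : a ∈ s) (hb : b ∈ s) (hab : a < b)
    (hgap : ∀ η ∈ s, η ≤ a ∨ b ≤ η) :
    (derivative (Lagrange.nodal s id)).eval a * (derivative (Lagrange.nodal s id)).eval b < 0 := by
  have hda := Lagrange.eval_nodal_derivative_eval_node_eq (v := (id : ℝ → ℝ)) ha
  have hdb := Lagrange.eval_nodal_derivative_eval_node_eq (v := (id : ℝ → ℝ)) hb
  rw [Lagrange.nodal_eq_mul_nodal_erase (Finset.mem_erase.2 ⟨hab.ne', hb⟩)] at hda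
  rw [Lagrange.nodal_eq_mul_nodal_erase (Finset.mem_erase.2 ⟨hab.ne, ha⟩),
    Finset.erase_right_comm] at hdb
  simp only [id, eval_mul, eval_sub, eval_X, eval_C] at hda hdb
  have hpos : 0 < (Lagrange.nodal ((s.erase a).erase b) id).eval a
      * (Lagrange.nodal ((s.erase a).erase b) id).eval b := by
    refine eval_nodal_mul_pos fun η hη => ?_
    obtain ⟨hηb, hηa, hηs⟩ : η ≠ b ∧ η ≠ a ∧ η ∈ s := by simpa using hη
    rcases hgap η hηs with hle | hle
    · exact Or.inl ⟨hle.lt_of_ne hηa, (hle.lt_of_ne hηa).trans hab⟩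
    · exact Or.inr ⟨hab.trans (hle.lt_of_ne' hηb), hle.lt_of_ne' hηb⟩
  rw [hda, hdb]
  nlinarith [mul_pos (pow_pos (sub_pos.2 hab) 2) hpos]

theorem exists_mem_Ioo_eq_zero {f : ℝ → ℝ} {a b : ℝ} (hab : a ≤ b)
    (hf : ContinuousOn f (Set.Icc a b)) (h : f a * f b < 0) : ∃ c ∈ Set.Ioo a b, f c = 0 := by
  rcases mul_neg_iff.1 h with ⟨ha, hb⟩ | ⟨ha, hb⟩
  · exact intermediate_value_Ioo' hab hf ⟨hb, ha⟩
  · exact intermediate_value_Ioo hab hf ⟨ha, hb⟩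

theorem exists_strictMono_zeros_of_alternating {s : Finset ℝ} {n : ℕ} (hs : s.card = n + 1)
    {f : ℝ → ℝ} (hf : Continuous f)
    (halt : ∀ a ∈ s, ∀ b ∈ s, a < b → (∀ η ∈ s, η ≤ a ∨ b ≤ η) → f a * f b < 0) :
    ∃ g : Fin n → ℝ, StrictMono g ∧ ∀ i, (∃ ξ ∈ s, ξ < g i) ∧ f (g i) = 0 := by
  set e := s.orderEmbOfFin hs
  have hmem i : e i ∈ s := s.orderEmbOfFin_mem hs i
  have hgap (i : Fin n) : ∀ η ∈ s, η ≤ e i.castSucc ∨ e i.succ ≤ η := by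
    intro η hη
    obtain ⟨j, rfl⟩ : η ∈ Set.range e := by rwa [Finset.range_orderEmbOfFin]
    rw [e.le_iff_le, e.le_iff_le, ← Fin.castSucc_lt_iff_succ_le]
    exact le_or_gt j i.castSucc
  have hzero (i : Fin n) : ∃ c ∈ Set.Ioo (e i.castSucc) (e i.succ), f c = 0 := by
    have hlt : e i.castSucc < e i.succ := e.strictMono Fin.castSucc_lt_succ
    exact exists_mem_Ioo_eq_zero hlt.le hf.continuousOn
      (halt _ (hmem _) _ (hmem _) hlt (hgap i))
  choose g hg hg0 using hzero
  refine ⟨g, fun i j hij => ?_, fun i => ⟨⟨_, hmem _, (hg i).1⟩, hg0 i⟩⟩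
  calc g i < e i.succ := (hg i).2
    _ ≤ e j.castSucc := e.monotone (Fin.succ_le_castSucc_iff.2 hij)
    _ < g j := (hg j).1

theorem IsMonicOrthogonal.eval_mul_eval_neg_of_adjacent (h : IsMonicOrthogonal L π)
    (hL : IsPositiveOn L S) {n : ℕ} {a b : ℝ} (ha : a ∈ (π (n + 1)).roots.toFinset)
    (hb : b ∈ (π (n + 1)).roots.toFinset) (hab : a < b)
    (hgap : ∀ η ∈ (π (n + 1)).roots.toFinset, η ≤ a ∨ b ≤ η) :
    (π n).eval a * (π n).eval b < 0 := by
  have hw {ξ : ℝ} (hξ : ξ ∈ (π (n + 1)).roots.toFinset) :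
      0 < (derivative (π (n + 1))).eval ξ * (π n).eval ξ := by
    have hroot : (π (n + 1)).eval ξ = 0 := (mem_roots'.1 (Multiset.mem_toFinset.1 hξ)).2
    simpa [hroot] using h.wronskian_pos hL n ξ
  have hder := derivative_nodal_mul_neg ha hb hab hgap
  rw [← h.eq_nodal hL (n + 1)] at hder
  refine neg_of_mul_pos_right ?_ hder.le
  calc 0 < _ := mul_pos (hw ha) (hw hb)
    _ = _ := by ring

theorem IsMonicOrthogonal.exists_strictMono_zeros_crossSum
    (h : IsMonicOrthogonal L π) (hL : IsPositiveOn L (Set.Ici 1))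
    (hρ : IsMonicOrthogonal (L ∘ₗ LinearMap.mulLeft ℝ (X ^ 2 - 1)) ρ) (n : ℕ) :
    ∃ g : Fin n → ℝ, StrictMono g ∧
      ∀ i, 1 < g i ∧ (crossSum (π (n + 1)) (ρ n)).eval (g i) = 0 := by
  obtain ⟨α, δ, hα, hrel⟩ := h.exists_christoffel hL hρ n
  set s := (π (n + 1)).roots.toFinset
  have hroot {ξ : ℝ} (hξ : ξ ∈ s) : (π (n + 1)).eval ξ = 0 :=
    (mem_roots'.1 (Multiset.mem_toFinset.1 hξ)).2
  have hone {ξ : ℝ} (hξ : ξ ∈ s) : 1 < ξ := h.lt_of_eval_eq_zero hL (hroot hξ)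
  have hρs {ξ : ℝ} (hξ : ξ ∈ s) : (ξ ^ 2 - 1) * (ρ n).eval ξ = α * (π n).eval ξ := by
    simpa [hroot hξ] using congrArg (eval ξ) hrel
  have hcross {ξ : ℝ} (hξ : ξ ∈ s) :
      (crossSum (π (n + 1)) (ρ n)).eval ξ = (π (n + 1)).eval (-ξ) * (ρ n).eval ξ := by
    rw [eval_crossSum, hroot hξ, zero_mul, zero_add]
  have halt : ∀ a ∈ s, ∀ b ∈ s, a < b → (∀ η ∈ s, η ≤ a ∨ b ≤ η) →
      (crossSum (π (n + 1)) (ρ n)).eval a * (crossSum (π (n + 1)) (ρ n)).eval b < 0 := by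
    intro a ha b hb hab hgap
    have hneg : 0 < (π (n + 1)).eval (-a) * (π (n + 1)).eval (-b) := by
      rw [h.eq_nodal hL (n + 1)]
      exact eval_nodal_mul_pos fun ξ hξ => Or.inr
        ⟨by linarith [hone hξ, hone ha], by linarith [hone hξ, hone hb]⟩
    have hsq {ξ : ℝ} (hξ : ξ ∈ s) : 0 < ξ ^ 2 - 1 := by nlinarith [hone hξ]
    have hρneg : (ρ n).eval a * (ρ n).eval b < 0 := by
      refine neg_of_mul_neg_right ?_ (mul_pos (hsq ha) (hsq hb)).le
      calc _ = (a ^ 2 - 1) * (ρ n).eval a * ((b ^ 2 - 1) * (ρ n).eval b) := by ring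
        _ = α ^ 2 * ((π n).eval a * (π n).eval b) := by rw [hρs ha, hρs hb]; ring
        _ < 0 := mul_neg_of_pos_of_neg (by positivity)
          (h.eval_mul_eval_neg_of_adjacent hL ha hb hab hgap)
    rw [hcross ha, hcross hb, mul_mul_mul_comm]
    exact mul_neg_of_pos_of_neg hneg hρneg
  obtain ⟨g, hg, hg0⟩ := exists_strictMono_zeros_of_alternating
    (h.card_roots_toFinset hL (n + 1)) (crossSum (π (n + 1)) (ρ n)).continuous halt
  refine ⟨g, hg, fun i => ⟨?_, (hg0 i).2⟩⟩
  obtain ⟨ξ, hξ, hξg⟩ := (hg0 i).1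
  exact (hone hξ).trans hξg

/-! ### Odd labelling of the zeros of an even polynomial -/

/-- The labels `±1, …, ±n` as a finite set. -/
noncomputable def labels (n : ℕ) : Finset ℤ := (Finset.Icc (-n : ℤ) n).erase 0

theorem mem_labels {n : ℕ} {i : ℤ} : i ∈ labels n ↔ i ∈ idx n := by
  rw [labels, Finset.mem_erase, Finset.mem_Icc, ← abs_le]
  rfl

theorem card_labels (n : ℕ) : (labels n).card = 2 * n := by
  rw [labels, Finset.card_erase_of_mem (by simp), Int.card_Icc]
  omega

theorem neg_mem_idx {n : ℕ} {i : ℤ} (hi : i ∈ idx n) : -i ∈ idx n :=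
  ⟨neg_ne_zero.2 hi.1, by rw [abs_neg]; exact hi.2⟩

theorem exists_eq_succ_of_mem_idx {n : ℕ} {i : ℤ} (hi : i ∈ idx n) (hpos : 0 < i) :
    ∃ k : Fin n, i = (k : ℕ) + 1 := by
  have hle := (abs_le.1 hi.2).2
  exact ⟨⟨i.natAbs - 1, by omega⟩, by simp only; omega⟩

/-- The odd function on the labels `-n, …, n` with values `g 0, …, g (n - 1)` at `1, …, n`; it is
`0` at all other integers. -/
noncomputable def oddExtend {n : ℕ} (g : Fin n → ℝ) (i : ℤ) : ℝ :=
  if h : i.natAbs - 1 < n then i.sign * g ⟨i.natAbs - 1, h⟩ else 0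

section OddExtend

variable {n : ℕ} {g : Fin n → ℝ}

theorem oddExtend_succ (g : Fin n → ℝ) (k : Fin n) : oddExtend g ((k : ℕ) + 1) = g k := by
  have habs : ((k : ℤ) + 1).natAbs - 1 = k := by omega
  have hsign : ((k : ℤ) + 1).sign = 1 := Int.sign_eq_one_of_pos (by omega)
  simp only [oddExtend, habs, hsign, k.isLt, dif_pos, Int.cast_one, one_mul]

theorem oddExtend_neg (g : Fin n → ℝ) (i : ℤ) : oddExtend g (-i) = -oddExtend g i := by
  simp only [oddExtend, Int.natAbs_neg, Int.sign_neg, Int.cast_neg]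
  split_ifs
  · exact neg_mul _ _
  · exact neg_zero.symm

theorem lt_oddExtend {a : ℝ} (hg : ∀ k, a < g k) {i : ℤ} (hi : i ∈ idx n) (hpos : 0 < i) :
    a < oddExtend g i := by
  obtain ⟨k, rfl⟩ := exists_eq_succ_of_mem_idx hi hpos
  rw [oddExtend_succ]
  exact hg k

theorem oddExtend_strictMonoOn (hg : StrictMono g) (hpos : ∀ k, 0 < g k) :
    StrictMonoOn (oddExtend g) (idx n) := by
  have hlt {i j : ℤ} (hi : i ∈ idx n) (hj : j ∈ idx n) (hi0 : 0 < i) (hij : i < j) :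
      oddExtend g i < oddExtend g j := by
    obtain ⟨k, rfl⟩ := exists_eq_succ_of_mem_idx hi hi0
    obtain ⟨m, rfl⟩ := exists_eq_succ_of_mem_idx hj (hi0.trans hij)
    rw [oddExtend_succ, oddExtend_succ]
    exact hg (by rw [Fin.lt_def]; omega)
  intro i hi j hj hij
  rcases hi.1.lt_or_gt with hi0 | hi0
  · rw [← neg_neg i, oddExtend_neg]
    rcases hj.1.lt_or_gt with hj0 | hj0
    · rw [← neg_neg j, oddExtend_neg (i := -j)]
      exact neg_lt_neg (hlt (neg_mem_idx hj) (neg_mem_idx hi) (by omega) (by omega))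
    · linarith [lt_oddExtend hpos hj hj0, lt_oddExtend hpos (neg_mem_idx hi) (by omega)]
  · exact hlt hi hj hi0 hij

theorem eval_neg_of_comp_neg_X {p : ℝ[X]} (hp : p.comp (-X) = p) (x : ℝ) :
    p.eval (-x) = p.eval x := by
  conv_rhs => rw [← hp, eval_comp, eval_neg, eval_X]

theorem roots_eq_image_oddExtend {p : ℝ[X]} (h0 : p ≠ 0) (hp : p.comp (-X) = p)
    (hdeg : p.natDegree ≤ 2 * n) (hg : StrictMono g) (hpos : ∀ k, 0 < g k)
    (hroot : ∀ k, p.eval (g k) = 0) : p.roots = ((labels n).image (oddExtend g)).val := by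
  refine roots_eq_of_natDegree_le_card_of_ne_zero (fun x hx => ?_) ?_ h0
  · obtain ⟨i, hi, rfl⟩ := Finset.mem_image.1 hx
    rw [mem_labels] at hi
    rcases hi.1.lt_or_gt with hi0 | hi0
    · obtain ⟨k, hk⟩ := exists_eq_succ_of_mem_idx (neg_mem_idx hi) (neg_pos.2 hi0)
      rw [← eval_neg_of_comp_neg_X hp, ← oddExtend_neg, hk, oddExtend_succ]
      exact hroot k
    · obtain ⟨k, rfl⟩ := exists_eq_succ_of_mem_idx hi hi0
      rw [oddExtend_succ]
      exact hroot k
  · rw [Finset.card_image_of_injOn, card_labels]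
    · exact hdeg
    · exact fun i hi j hj => (oddExtend_strictMonoOn hg hpos).injOn
        (mem_labels.1 hi) (mem_labels.1 hj)

theorem natDegree_eq_of_strictMono_zeros {p : ℝ[X]} (h0 : p ≠ 0) (hp : p.comp (-X) = p)
    (hdeg : p.natDegree ≤ 2 * n) (hg : StrictMono g) (hpos : ∀ k, 0 < g k)
    (hroot : ∀ k, p.eval (g k) = 0) : p.natDegree = 2 * n := by
  refine hdeg.antisymm ?_
  calc 2 * n = ((labels n).image (oddExtend g)).card := by
        rw [Finset.card_image_of_injOn, card_labels]
        exact fun i hi j hj => (oddExtend_strictMonoOn hg hpos).injOn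
          (mem_labels.1 hi) (mem_labels.1 hj)
    _ = p.roots.card := by rw [roots_eq_image_oddExtend h0 hp hdeg hg hpos hroot]; rfl
    _ ≤ p.natDegree := p.card_roots'

theorem range_eq_of_strictMono_zeros {p : ℝ[X]} (h0 : p ≠ 0) (hp : p.comp (-X) = p)
    (hdeg : p.natDegree ≤ 2 * n) (hg : StrictMono g) (hpos : ∀ k, 0 < g k)
    (hroot : ∀ k, p.eval (g k) = 0) : Set.range g = {x | 0 < x ∧ p.eval x = 0} := by
  refine Set.Subset.antisymm (Set.range_subset_iff.2 fun k => ⟨hpos k, hroot k⟩) ?_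
  rintro x ⟨hx, hx0⟩
  have hmem : x ∈ p.roots := (mem_roots h0).2 hx0
  rw [roots_eq_image_oddExtend h0 hp hdeg hg hpos hroot, Finset.mem_val] at hmem
  obtain ⟨i, hi, rfl⟩ := Finset.mem_image.1 hmem
  rw [mem_labels] at hi
  have hi0 : 0 < i := by
    by_contra! hle
    have := lt_oddExtend hpos (neg_mem_idx hi) (neg_pos.2 (hle.lt_of_ne hi.1))
    rw [oddExtend_neg] at this
    linarith
  obtain ⟨k, rfl⟩ := exists_eq_succ_of_mem_idx hi hi0
  exact ⟨k, (oddExtend_succ g k).symm⟩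

end OddExtend

/-! ### Monotonicity of the quotients -/

namespace IsMonicOrthogonal

theorem strictAntiOn_eval_div_eval {a : ℝ} (h : IsMonicOrthogonal L π)
    (hL : IsPositiveOn L (Set.Ici a)) (n : ℕ) :
    StrictAntiOn (fun x => (π n).eval x / (π (n + 1)).eval x) (Set.Iic a) := by
  obtain ⟨m, hm, hfrac⟩ := h.exists_partialFractions hL n
  set s := (π (n + 1)).roots.toFinset
  have hlt {ξ : ℝ} (hξ : ξ ∈ s) : a < ξ :=
    h.lt_of_eval_eq_zero hL (mem_roots'.1 (Multiset.mem_toFinset.1 hξ)).2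
  have hnotMem {x : ℝ} (hx : x ≤ a) : x ∉ s := fun hxs => hx.not_gt (hlt hxs)
  have hs : s.Nonempty := Finset.card_pos.1 (by rw [h.card_roots_toFinset hL]; exact n.succ_pos)
  intro x hx y hy hxy
  simp only [hfrac x (hnotMem hx), hfrac y (hnotMem hy)]
  refine Finset.sum_lt_sum_of_nonempty hs fun ξ hξ => ?_
  have hyξ : 0 < ξ - y := sub_pos.2 (lt_of_le_of_lt hy (hlt hξ))
  rw [← neg_sub ξ y, ← neg_sub ξ x, div_neg, div_neg, neg_lt_neg_iff]
  exact div_lt_div_of_pos_left (hm ξ hξ) hyξ (by linarith)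

theorem exists_hasDerivAt_evenRatio {a : ℝ} (ha : 0 ≤ a) (h : IsMonicOrthogonal L π)
    (hL : IsPositiveOn L (Set.Ici a)) {n : ℕ} {z : ℝ} (hz : 0 < z)
    (hne : (π (n + 1)).eval z ≠ 0) :
    ∃ d < 0, HasDerivAt (evenRatio (π n) (π (n + 1))) d z := by
  obtain ⟨m, hm, hfrac⟩ := h.exists_partialFractions hL n
  set s := (π (n + 1)).roots.toFinset
  have hroot {ξ : ℝ} (hξ : ξ ∈ s) : (π (n + 1)).eval ξ = 0 :=
    (mem_roots'.1 (Multiset.mem_toFinset.1 hξ)).2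
  have hpos {ξ : ℝ} (hξ : ξ ∈ s) : 0 < ξ := ha.trans_lt (h.lt_of_eval_eq_zero hL (hroot hξ))
  have hzs : z ∉ s := fun hξ => hne (hroot hξ)
  have hs : s.Nonempty := Finset.card_pos.1 (by rw [h.card_roots_toFinset hL]; exact n.succ_pos)
  have hev : evenRatio (π n) (π (n + 1)) =ᶠ[nhds z]
      fun x => ∑ ξ ∈ s, (m ξ / (x - ξ) + m ξ / (-x - ξ)) := by
    filter_upwards [s.isClosed.isOpen_compl.mem_nhds (show z ∈ (s : Set ℝ)ᶜ from hzs),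
      lt_mem_nhds hz] with x hx hx0
    rw [Finset.sum_add_distrib, evenRatio, hfrac x hx,
      hfrac (-x) fun hξ => (neg_neg_of_pos hx0).not_gt (hpos hξ)]
  refine ⟨∑ ξ ∈ s, (-(m ξ / (z - ξ) ^ 2) + m ξ / (z + ξ) ^ 2), ?_, ?_⟩
  · refine Finset.sum_neg (fun ξ hξ => ?_) hs
    have hsub : z - ξ ≠ 0 := fun h0 => hzs (sub_eq_zero.1 h0 ▸ hξ)
    have hlt : m ξ / (z + ξ) ^ 2 < m ξ / (z - ξ) ^ 2 :=
      div_lt_div_of_pos_left (hm ξ hξ) (by positivity) (by nlinarith [mul_pos hz (hpos hξ)])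
    linarith
  · refine (HasDerivAt.fun_sum fun ξ hξ => ?_).congr_of_eventuallyEq hev
    have hsub : z - ξ ≠ 0 := fun h0 => hzs (sub_eq_zero.1 h0 ▸ hξ)
    have hadd : -z - ξ ≠ 0 := by linarith [hpos hξ]
    have hleft := (((hasDerivAt_id z).sub_const ξ).fun_inv hsub).const_mul (m ξ)
    have hright := (((hasDerivAt_id z).fun_neg.sub_const ξ).fun_inv hadd).const_mul (m ξ)
    refine (hleft.fun_add hright).congr_deriv ?_
    simp only [id]
    rw [show -z - ξ = -(z + ξ) by ring, neg_sq]
    ring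

end IsMonicOrthogonal

/-! ### Deformation of the weight by an exponential factor -/

theorem exists_implicitFunction_hasDerivAt {F : ℝ × ℝ → ℝ} {a b e d : ℝ}
    (hF : ContDiffAt ℝ 1 F (a, b)) (he : HasDerivAt (fun s => F (s, b)) e a)
    (hd : HasDerivAt (fun x => F (a, x)) d b) (hd0 : d ≠ 0) :
    ∃ ψ : ℝ → ℝ, ψ a = b ∧ HasDerivAt ψ (-e / d) a ∧ ∀ᶠ s in nhds a, F (s, ψ s) = F (a, b) := by
  have hfd := (hF.differentiableAt one_ne_zero).hasFDerivAt
  have hcurve {γ : ℝ → ℝ} {γ' : ℝ} (hγ : HasDerivAt γ γ' a) (hγa : γ a = b) :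
      HasDerivAt (fun s => F (s, γ s)) (fderiv ℝ F (a, b) (1, γ')) a := by
    rw [← hγa] at hfd ⊢
    exact hfd.comp_hasDerivAt a ((hasDerivAt_id a).prodMk hγ)
  have hfst : fderiv ℝ F (a, b) (1, 0) = e := (hcurve (hasDerivAt_const a b) rfl).unique he
  have hsnd : fderiv ℝ F (a, b) (0, 1) = d :=
    HasDerivAt.unique (f := fun x => F (a, x))
      (hfd.comp_hasDerivAt b ((hasDerivAt_const b a).prodMk (hasDerivAt_id b))) hd
  have hinv : (fderiv ℝ F (a, b) ∘L .inr ℝ ℝ ℝ).IsInvertible :=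
    ⟨ContinuousLinearEquiv.unitsEquivAut ℝ (Units.mk0 d hd0), by ext; simp [hsnd]⟩
  have hψ := (hF.hasStrictFDerivAt_implicitFunction one_ne_zero hinv).hasFDerivAt.hasDerivAt
  have hval := hF.implicitFunction_apply_self one_ne_zero hinv
  have hconst := hF.eventually_apply_implicitFunction one_ne_zero hinv
  refine ⟨_, hval, hψ.congr_deriv ?_, hconst⟩
  set ψ' := (_ : ℝ →L[ℝ] ℝ) 1
  have hzero : fderiv ℝ F (a, b) (1, ψ') = 0 :=
    (hcurve hψ hval).unique ((hasDerivAt_const a (F (a, b))).congr_of_eventuallyEq hconst)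
  have hsplit : ((1, ψ') : ℝ × ℝ) = (1, 0) + ψ' • (0, 1) := by simp
  rw [hsplit, map_add, map_smul, hfst, hsnd, smul_eq_mul] at hzero
  rw [eq_div_iff hd0]
  linarith

/-- A family of positive functionals `L s` on `S` with its monic orthogonal polynomials `π s`, for
`s` in an open set `U`, which evolves like integration against a measure with density
proportional to `exp (-s x)`. The induced flow of the polynomials is the Toda flow. -/
structure IsTodaDeformation (L : ℝ → ℝ[X] →ₗ[ℝ] ℝ) (π : ℝ → ℕ → ℝ[X]) (S U : Set ℝ) : Prop where
  isOpen : IsOpen U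
  isPositiveOn : ∀ s ∈ U, IsPositiveOn (L s) S
  isMonicOrthogonal : ∀ s ∈ U, IsMonicOrthogonal (L s) (π s)
  hasDerivAt : ∀ s ∈ U, ∀ f, HasDerivAt (fun t => L t f) (-L s (X * f)) s

namespace IsTodaDeformation

variable {L : ℝ → ℝ[X] →ₗ[ℝ] ℝ} {π : ℝ → ℕ → ℝ[X]} {S U : Set ℝ} {ζ : ℝ}

theorem contDiffOn_apply (h : IsTodaDeformation L π S U) (f : ℝ[X]) :
    ContDiffOn ℝ 1 (fun s => L s f) U := by
  rw [show (1 : WithTop ℕ∞) = 0 + 1 from (zero_add 1).symm,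
    contDiffOn_succ_iff_deriv_of_isOpen h.isOpen]
  refine ⟨fun s hs => (h.hasDerivAt s hs f).differentiableAt.differentiableWithinAt,
    fun hω => absurd hω (by simp), contDiffOn_zero.2 ?_⟩
  have hcont : ContinuousOn (fun s => -L s (X * f)) U := fun s hs =>
    (h.hasDerivAt s hs (X * f)).continuousAt.neg.continuousWithinAt
  exact hcont.congr fun s hs => (h.hasDerivAt s hs f).deriv

theorem eq_X_pow_add_sum (h : IsTodaDeformation L π S U) {s : ℝ} (hs : s ∈ U) (n : ℕ) :
    π s n = X ^ n + ∑ i ∈ Finset.range n, C ((π s n).coeff i) * X ^ i := by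
  have hπ := h.isMonicOrthogonal s hs
  conv_lhs => rw [(hπ.monic n).as_sum, hπ.natDegree_eq]

theorem apply_eq_add_sum (h : IsTodaDeformation L π S U) {s : ℝ} (hs : s ∈ U) (n : ℕ) (q : ℝ[X]) :
    L s (π s n * q) = L s (X ^ n * q)
      + ∑ i ∈ Finset.range n, (π s n).coeff i * L s (X ^ i * q) := by
  conv_lhs => rw [h.eq_X_pow_add_sum hs n]
  simp only [add_mul, Finset.sum_mul, map_add, map_sum, ← smul_eq_C_mul, smul_mul_assoc, map_smul,
    smul_eq_mul]

theorem eval_eq_add_sum (h : IsTodaDeformation L π S U) {s : ℝ} (hs : s ∈ U) (n : ℕ) (x : ℝ) :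
    (π s n).eval x = x ^ n + ∑ i ∈ Finset.range n, (π s n).coeff i * x ^ i := by
  conv_lhs => rw [h.eq_X_pow_add_sum hs n]
  simp only [eval_add, eval_pow, eval_X, eval_finsetSum, eval_mul, eval_C]

theorem contDiffOn_coeff (h : IsTodaDeformation L π S U) (n j : ℕ) :
    ContDiffOn ℝ 1 (fun s => (π s n).coeff j) U := by
  induction n using Nat.strong_induction_on generalizing j with
  | _ n ih =>
    have happly {k : ℕ} (hk : k < n) (q : ℝ[X]) : ContDiffOn ℝ 1 (fun s => L s (π s k * q)) U :=
      ((h.contDiffOn_apply _).add (ContDiffOn.sum fun i _ =>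
        (ih k hk i).mul (h.contDiffOn_apply _))).congr fun s hs => h.apply_eq_add_sum hs k q
    have hnorm {s : ℝ} (hs : s ∈ U) (k : ℕ) : L s (π s k * π s k) = L s (π s k * X ^ k) := by
      have hπ := h.isMonicOrthogonal s hs
      rw [hπ.apply_mul (natDegree_X_pow_le k), coeff_X_pow_self, one_mul]
    have hne {s : ℝ} (hs : s ∈ U) (k : ℕ) : L s (π s k * X ^ k) ≠ 0 := by
      rw [← hnorm hs]
      exact (h.isMonicOrthogonal s hs).apply_mul_self_ne_zero (h.isPositiveOn s hs) k
    have hsmooth : ContDiffOn ℝ 1 (fun s => (X ^ n : ℝ[X]).coeff j - ∑ k ∈ Finset.range n,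
        L s (π s k * X ^ n) / L s (π s k * X ^ k) * (π s k).coeff j) U :=
      contDiffOn_const.sub <| ContDiffOn.sum fun k hk =>
        have hkn := Finset.mem_range.1 hk
        ((happly hkn _).div (happly hkn _) fun s hs => hne hs k).mul (ih k hkn j)
    refine hsmooth.congr fun s hs => ?_
    have hπ := h.isMonicOrthogonal s hs
    conv_lhs =>
      rw [hπ.eq_X_pow_sub_sum (hπ.apply_mul_self_ne_zero (h.isPositiveOn s hs)) n]
    simp only [coeff_sub, finsetSum_coeff, coeff_C_mul, hnorm hs, mul_comm (X ^ n) (π s _)]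

theorem contDiffAt_eval (h : IsTodaDeformation L π S U) (hζ : ζ ∈ U) (n : ℕ) {f : ℝ × ℝ → ℝ}
    {x : ℝ} (hf : ContDiffAt ℝ 1 f (ζ, x)) :
    ContDiffAt ℝ 1 (fun v : ℝ × ℝ => (π v.1 n).eval (f v)) (ζ, x) := by
  have hU : U ∈ nhds ζ := h.isOpen.mem_nhds hζ
  have hsum : ContDiffAt ℝ 1 (fun v : ℝ × ℝ => f v ^ n
      + ∑ i ∈ Finset.range n, (π v.1 n).coeff i * f v ^ i) (ζ, x) :=
    (hf.pow n).add <| ContDiffAt.sum fun i _ =>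
      ContDiffAt.mul (((h.contDiffOn_coeff n i).contDiffAt hU).comp (ζ, x) contDiffAt_fst)
        (hf.pow i)
  refine hsum.congr_of_eventuallyEq ?_
  filter_upwards [continuousAt_fst.eventually hU] with v hv
  exact h.eval_eq_add_sum hv n (f v)

theorem hasDerivAt_coeff (h : IsTodaDeformation L π S U) (hζ : ζ ∈ U) (n i : ℕ) :
    HasDerivAt (fun s => (π s n).coeff i) (deriv (fun s => (π s n).coeff i) ζ) ζ :=
  (((h.contDiffOn_coeff n i).contDiffAt (h.isOpen.mem_nhds hζ)).differentiableAt
    one_ne_zero).hasDerivAt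

theorem exists_polynomial_hasDerivAt (h : IsTodaDeformation L π S U) (hζ : ζ ∈ U) (n : ℕ) :
    ∃ D : ℝ[X], D.degree < n ∧ (∀ x, HasDerivAt (fun s => (π s n).eval x) (D.eval x) ζ) ∧
      ∀ q, HasDerivAt (fun s => L s (π s n * q)) (L ζ (D * q) - L ζ (X * π ζ n * q)) ζ := by
  set c : ℕ → ℝ := fun i => deriv (fun s => (π s n).coeff i) ζ
  have hU : ∀ᶠ s in nhds ζ, s ∈ U := h.isOpen.mem_nhds hζ
  refine ⟨∑ i ∈ Finset.range n, C (c i) * X ^ i,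
    degree_sum_C_mul_lt c fun k hk => by rw [degree_X_pow]; exact_mod_cast hk,
    fun x => ?_, fun q => ?_⟩
  · refine HasDerivAt.congr_of_eventuallyEq ?_ (hU.mono fun s hs => h.eval_eq_add_sum hs n x)
    refine ((HasDerivAt.fun_sum fun i _ =>
      (h.hasDerivAt_coeff hζ n i).mul_const (x ^ i)).const_add (x ^ n)).congr_deriv ?_
    simp only [eval_finsetSum, eval_mul, eval_C, eval_pow, eval_X, c]
  · refine HasDerivAt.congr_of_eventuallyEq ?_ (hU.mono fun s hs => h.apply_eq_add_sum hs n q)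
    refine ((h.hasDerivAt ζ hζ _).fun_add (HasDerivAt.fun_sum fun i _ =>
      (h.hasDerivAt_coeff hζ n i).fun_mul (h.hasDerivAt ζ hζ _))).congr_deriv ?_
    have hX : L ζ (X * π ζ n * q) = L ζ (X * (X ^ n * q))
        + ∑ i ∈ Finset.range n, (π ζ n).coeff i * L ζ (X * (X ^ i * q)) := by
      rw [show X * π ζ n * q = π ζ n * (X * q) by ring, h.apply_eq_add_sum hζ]
      simp only [mul_left_comm X]
    have hD : L ζ ((∑ i ∈ Finset.range n, C (c i) * X ^ i) * q)
        = ∑ i ∈ Finset.range n, c i * L ζ (X ^ i * q) := by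
      simp only [Finset.sum_mul, map_sum, ← smul_eq_C_mul, smul_mul_assoc, map_smul, smul_eq_mul]
    rw [hX, hD, Finset.sum_add_distrib]
    simp only [mul_neg, Finset.sum_neg_distrib]
    ring

theorem hasDerivAt_eval_succ (h : IsTodaDeformation L π S U) (hζ : ζ ∈ U) (n : ℕ) (x : ℝ) :
    HasDerivAt (fun s => (π s (n + 1)).eval x)
      (L ζ (π ζ (n + 1) * π ζ (n + 1)) / L ζ (π ζ n * π ζ n) * (π ζ n).eval x) ζ := by
  have hπ := h.isMonicOrthogonal ζ hζ
  have hne := hπ.apply_mul_self_ne_zero (h.isPositiveOn ζ hζ)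
  obtain ⟨D, hDdeg, hDeval, hDapply⟩ := h.exists_polynomial_hasDerivAt hζ (n + 1)
  have hD {q : ℝ[X]} (hq : q.degree < (n + 1 : ℕ)) :
      L ζ (D * q) = L ζ (X * π ζ (n + 1) * q) := by
    refine sub_eq_zero.1 ((hDapply q).unique
      ((hasDerivAt_const ζ (0 : ℝ)).congr_of_eventuallyEq ?_))
    filter_upwards [h.isOpen.mem_nhds hζ] with s hs
    exact (h.isMonicOrthogonal s hs).apply_mul_eq_zero (n + 1) q hq
  have hlow : ∀ k ∈ Finset.range n, C (L ζ (D * π ζ k) / L ζ (π ζ k * π ζ k)) * π ζ k = 0 :=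
    fun k hk => by
      have hkn := Finset.mem_range.1 hk
      rw [hD (hπ.degree_lt (hkn.trans n.lt_succ_self)),
        hπ.apply_X_mul_mul_eq_zero n (hπ.degree_lt hkn), zero_div, C_0, zero_mul]
  have htop : L ζ (D * π ζ n) = L ζ (π ζ (n + 1) * π ζ (n + 1)) := by
    rw [hD (hπ.degree_lt n.lt_succ_self), mul_right_comm, hπ.apply_X_mul_mul_succ]
  have hexp := hπ.eq_sum hne hDdeg
  rw [Finset.sum_range_succ, Finset.sum_eq_zero hlow, zero_add, htop] at hexp
  refine (hDeval x).congr_deriv ?_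
  rw [hexp, eval_mul, eval_C]

theorem exists_hasDerivAt_eval (h : IsTodaDeformation L π S U) (hζ : ζ ∈ U) (n : ℕ) :
    ∃ b : ℝ, ∀ x, HasDerivAt (fun s => (π s n).eval x)
      ((x - b) * (π ζ n).eval x - (π ζ (n + 1)).eval x) ζ := by
  have hπ := h.isMonicOrthogonal ζ hζ
  rcases n with _ | n
  · obtain ⟨b, hb⟩ := hπ.one_eq_X_sub_C
    refine ⟨b, fun x => ((hasDerivAt_const ζ (1 : ℝ)).congr_of_eventuallyEq ?_).congr_deriv ?_⟩
    · filter_upwards [h.isOpen.mem_nhds hζ] with s hs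
      rw [(h.isMonicOrthogonal s hs).zero_eq_one, eval_one]
    · simp [hb, hπ.zero_eq_one]
  · obtain ⟨b, hb⟩ := hπ.recurrence (hπ.apply_mul_self_ne_zero (h.isPositiveOn ζ hζ)) n
    refine ⟨b, fun x => (h.hasDerivAt_eval_succ hζ n x).congr_deriv ?_⟩
    rw [hb]
    simp

theorem exists_riccati (h : IsTodaDeformation L π S U) (hζ : ζ ∈ U) (n : ℕ) :
    ∃ a b : ℝ, 0 < a ∧ ∀ x, (π ζ (n + 1)).eval x ≠ 0 →
      HasDerivAt (fun s => (π s n).eval x / (π s (n + 1)).eval x)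
        ((x - b) * ((π ζ n).eval x / (π ζ (n + 1)).eval x) - 1
          - a * ((π ζ n).eval x / (π ζ (n + 1)).eval x) ^ 2) ζ := by
  have hpos := (h.isMonicOrthogonal ζ hζ).apply_mul_self_pos (h.isPositiveOn ζ hζ)
  obtain ⟨b, hb⟩ := h.exists_hasDerivAt_eval hζ n
  refine ⟨_, b, div_pos (hpos (n + 1)) (hpos n), fun x hx => ?_⟩
  refine ((hb x).fun_div (h.hasDerivAt_eval_succ hζ n x) hx).congr_deriv ?_
  field_simp

end IsTodaDeformation

/-! ### Motion of the zeros of the cross sums -/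

theorem IsPositiveOn.comp_mulLeft_X_sq_sub_one (hL : IsPositiveOn L (Set.Ici 1)) :
    IsPositiveOn (L ∘ₗ LinearMap.mulLeft ℝ (X ^ 2 - 1)) (Set.Ici 1) := by
  refine hL.comp_mulLeft (X_pow_sub_C_ne_zero two_pos 1) fun x hx => ?_
  have hsq : (X ^ 2 - 1 : ℝ[X]).eval x = x ^ 2 - 1 := by simp
  rw [hsq]
  nlinarith [Set.mem_Ici.1 hx]

namespace IsMonicOrthogonal

theorem crossSum_ne_zero (h : IsMonicOrthogonal L π) (hL : IsPositiveOn L (Set.Ici 1))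
    (hρ : IsMonicOrthogonal (L ∘ₗ LinearMap.mulLeft ℝ (X ^ 2 - 1)) ρ) (n : ℕ) :
    crossSum (π (n + 1)) (ρ n) ≠ 0 := by
  have hπ0 := h.eval_ne_zero_of_le hL (n + 1) zero_le_one
  have hρ0 := hρ.eval_ne_zero_of_le hL.comp_mulLeft_X_sq_sub_one n zero_le_one
  have h0 : (crossSum (π (n + 1)) (ρ n)).eval 0 = 2 * ((π (n + 1)).eval 0 * (ρ n).eval 0) := by
    rw [eval_crossSum, neg_zero]
    ring
  intro hzero
  rw [hzero, eval_zero] at h0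
  exact mul_ne_zero two_ne_zero (mul_ne_zero hπ0 hρ0) h0.symm

theorem range_eq_zeros_crossSum (h : IsMonicOrthogonal L π) (hL : IsPositiveOn L (Set.Ici 1))
    (hρ : IsMonicOrthogonal (L ∘ₗ LinearMap.mulLeft ℝ (X ^ 2 - 1)) ρ) {n : ℕ} {g : Fin n → ℝ}
    (hg : StrictMono g) (hpos : ∀ k, 1 < g k)
    (hroot : ∀ k, (crossSum (π (n + 1)) (ρ n)).eval (g k) = 0) :
    Set.range g = {x | 0 < x ∧ (crossSum (π (n + 1)) (ρ n)).eval x = 0} :=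
  range_eq_of_strictMono_zeros (h.crossSum_ne_zero hL hρ n) (crossSum_comp_neg_X _ _)
    (natDegree_crossSum_le (h.natDegree_eq _).le (hρ.natDegree_eq _).le) hg
    (fun k => one_pos.trans (hpos k)) hroot

theorem evenRatio_eq_of_eval_crossSum_eq_zero (h : IsMonicOrthogonal L π)
    (hL : IsPositiveOn L (Set.Ici 1))
    (hρ : IsMonicOrthogonal (L ∘ₗ LinearMap.mulLeft ℝ (X ^ 2 - 1)) ρ) {n : ℕ} {z : ℝ} (hz : 1 < z)
    (hroot : (crossSum (π (n + 1)) (ρ n)).eval z = 0) :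
    evenRatio (π n) (π (n + 1)) z = evenRatio (π n) (π (n + 1)) 1 := by
  obtain ⟨α, hα, hcross⟩ := h.exists_eval_crossSum hL hρ n
  have hne := h.eval_ne_zero_of_eval_crossSum_eq_zero hL hρ (by linarith) hroot
  have hne' := h.eval_ne_zero_of_le hL (n + 1) (show -z ≤ 1 by linarith)
  have hval := hcross z hne hne'
  rw [hroot, mul_zero] at hval
  have hprod := mul_ne_zero hα (mul_ne_zero hne hne')
  exact sub_eq_zero.1 ((mul_eq_zero.1 hval.symm).resolve_left hprod)

theorem eval_crossSum_eq_zero_of_evenRatio_eq (h : IsMonicOrthogonal L π)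
    (hL : IsPositiveOn L (Set.Ici 1))
    (hρ : IsMonicOrthogonal (L ∘ₗ LinearMap.mulLeft ℝ (X ^ 2 - 1)) ρ) {n : ℕ} {z : ℝ} (hz : 1 < z)
    (hne : (π (n + 1)).eval z ≠ 0)
    (hz1 : evenRatio (π n) (π (n + 1)) z = evenRatio (π n) (π (n + 1)) 1) :
    (crossSum (π (n + 1)) (ρ n)).eval z = 0 := by
  obtain ⟨α, -, hcross⟩ := h.exists_eval_crossSum hL hρ n
  have hval := hcross z hne (h.eval_ne_zero_of_le hL (n + 1) (show -z ≤ 1 by linarith))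
  rw [hz1, sub_self, mul_zero] at hval
  exact (mul_eq_zero.1 hval).resolve_left (by nlinarith)

end IsMonicOrthogonal

theorem riccati_sum_neg {a b z S T S₁ T₁ : ℝ} (ha : 0 < a) (hz : 1 < z) (hST : S + T = S₁ + T₁)
    (h₁ : S₁ < T₁) (hT : T₁ < T) :
    ((z - b) * S - 1 - a * S ^ 2) + ((-z - b) * T - 1 - a * T ^ 2)
      - (((1 - b) * S₁ - 1 - a * S₁ ^ 2) + ((-1 - b) * T₁ - 1 - a * T₁ ^ 2)) < 0 := by
  have hpos : 0 < (z - 1) * (T₁ - S₁) + 2 * z * (T - T₁) + 2 * a * ((T - T₁) * (T - S₁)) := by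
    have hz1 := mul_pos (sub_pos.2 hz) (sub_pos.2 h₁)
    have hz2 := mul_pos (one_pos.trans hz) (sub_pos.2 hT)
    have hT1 := mul_pos ha (mul_pos (sub_pos.2 hT) (sub_pos.2 (h₁.trans hT)))
    linarith
  obtain rfl : S = S₁ + T₁ - T := eq_sub_of_add_eq hST
  linarith

namespace IsTodaDeformation

variable {L : ℝ → ℝ[X] →ₗ[ℝ] ℝ} {π ρ : ℝ → ℕ → ℝ[X]} {U : Set ℝ} {ζ : ℝ} {n : ℕ}

theorem exists_hasDerivAt_evenRatio_sub (h : IsTodaDeformation L π (Set.Ici 1) U) (hζ : ζ ∈ U)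
    {z : ℝ} (hz : 1 < z) (hne : (π ζ (n + 1)).eval z ≠ 0)
    (hz1 : evenRatio (π ζ n) (π ζ (n + 1)) z = evenRatio (π ζ n) (π ζ (n + 1)) 1) :
    ∃ e < 0, HasDerivAt (fun s => evenRatio (π s n) (π s (n + 1)) z
      - evenRatio (π s n) (π s (n + 1)) 1) e ζ := by
  have hπ := h.isMonicOrthogonal ζ hζ
  have hL := h.isPositiveOn ζ hζ
  obtain ⟨a, b, ha, hric⟩ := h.exists_riccati hζ n
  have hne' {x : ℝ} (hx : x ≤ 1) := hπ.eval_ne_zero_of_le hL (n + 1) hx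
  have hanti := hπ.strictAntiOn_eval_div_eval hL n
  have hder := ((hric z hne).fun_add (hric (-z) (hne' (by linarith)))).fun_sub
    ((hric 1 (hne' le_rfl)).fun_add (hric (-1) (hne' (by norm_num))))
  refine ⟨_, riccati_sum_neg ha hz hz1 ?_ ?_, hder⟩
  · exact hanti (show (-1 : ℝ) ≤ 1 by norm_num) Set.self_mem_Iic (by norm_num)
  · exact hanti (show -z ≤ 1 by linarith) (show (-1 : ℝ) ≤ 1 by norm_num) (by linarith)

theorem contDiffAt_evenRatio (h : IsTodaDeformation L π (Set.Ici 1) U) (hζ : ζ ∈ U)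
    {f : ℝ × ℝ → ℝ} {x : ℝ} (hf : ContDiffAt ℝ 1 f (ζ, x))
    (hne : (π ζ (n + 1)).eval (f (ζ, x)) ≠ 0) (hne' : (π ζ (n + 1)).eval (-f (ζ, x)) ≠ 0) :
    ContDiffAt ℝ 1 (fun v : ℝ × ℝ => evenRatio (π v.1 n) (π v.1 (n + 1)) (f v)) (ζ, x) :=
  ((h.contDiffAt_eval hζ n hf).div (h.contDiffAt_eval hζ (n + 1) hf) hne).add
    ((h.contDiffAt_eval hζ n hf.neg).div (h.contDiffAt_eval hζ (n + 1) hf.neg) hne')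

theorem exists_moving_zero (h : IsTodaDeformation L π (Set.Ici 1) U)
    (hρ : ∀ s ∈ U, IsMonicOrthogonal (L s ∘ₗ LinearMap.mulLeft ℝ (X ^ 2 - 1)) (ρ s)) (hζ : ζ ∈ U)
    {z : ℝ} (hz : 1 < z) (hroot : (crossSum (π ζ (n + 1)) (ρ ζ n)).eval z = 0) :
    ∃ ψ : ℝ → ℝ, ψ ζ = z ∧ (∃ d < 0, HasDerivAt ψ d ζ) ∧
      ∀ᶠ s in nhds ζ, (crossSum (π s (n + 1)) (ρ s n)).eval (ψ s) = 0 := by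
  have hπ := h.isMonicOrthogonal ζ hζ
  have hL := h.isPositiveOn ζ hζ
  have hne := hπ.eval_ne_zero_of_eval_crossSum_eq_zero hL (hρ ζ hζ) (by linarith) hroot
  have hne' {x : ℝ} (hx : x ≤ 1) := hπ.eval_ne_zero_of_le hL (n + 1) hx
  have hz1 := hπ.evenRatio_eq_of_eval_crossSum_eq_zero hL (hρ ζ hζ) hz hroot
  obtain ⟨e, he, hes⟩ := h.exists_hasDerivAt_evenRatio_sub hζ hz hne hz1
  obtain ⟨d, hd, hdx⟩ := hπ.exists_hasDerivAt_evenRatio zero_le_one hL (one_pos.trans hz) hne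
  have hF : ContDiffAt ℝ 1 (fun v : ℝ × ℝ => evenRatio (π v.1 n) (π v.1 (n + 1)) v.2
      - evenRatio (π v.1 n) (π v.1 (n + 1)) 1) (ζ, z) :=
    (h.contDiffAt_evenRatio hζ contDiffAt_snd hne (hne' (by linarith : -z ≤ 1))).sub
      (h.contDiffAt_evenRatio hζ contDiffAt_const (hne' le_rfl) (hne' (by norm_num : (-1 : ℝ) ≤ 1)))
  obtain ⟨ψ, rfl, hψ, hzero⟩ := exists_implicitFunction_hasDerivAt hF hes
    (hdx.sub_const (evenRatio (π ζ n) (π ζ (n + 1)) 1)) hd.ne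
  have hcont : ContinuousAt (fun s => (π s (n + 1)).eval (ψ s)) ζ :=
    ContinuousAt.comp' (f := fun s => (s, ψ s))
      (h.contDiffAt_eval hζ (n + 1) contDiffAt_snd).continuousAt
      (continuousAt_id.prodMk hψ.continuousAt)
  refine ⟨ψ, rfl, ⟨-e / d, div_neg_of_pos_of_neg (neg_pos.2 he) hd, hψ⟩, ?_⟩
  filter_upwards [h.isOpen.mem_nhds hζ, hψ.continuousAt.eventually_const_lt hz,
    hcont.eventually_ne hne, hzero] with s hs hs1 hs0 hsF
  refine (h.isMonicOrthogonal s hs).eval_crossSum_eq_zero_of_evenRatio_eq (h.isPositiveOn s hs)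
    (hρ s hs) hs1 hs0 (sub_eq_zero.1 ?_)
  rw [hsF, hz1, sub_self]

theorem exists_hasDerivAt_zeros (h : IsTodaDeformation L π (Set.Ici 1) U)
    (hρ : ∀ s ∈ U, IsMonicOrthogonal (L s ∘ₗ LinearMap.mulLeft ℝ (X ^ 2 - 1)) (ρ s))
    {g : ℝ → Fin n → ℝ} (hmono : ∀ s ∈ U, StrictMono (g s)) (hone : ∀ s ∈ U, ∀ k, 1 < g s k)
    (hroot : ∀ s ∈ U, ∀ k, (crossSum (π s (n + 1)) (ρ s n)).eval (g s k) = 0) (hζ : ζ ∈ U)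
    (k : Fin n) : ∃ d < 0, HasDerivAt (fun s => g s k) d ζ := by
  have hmove (j : Fin n) := h.exists_moving_zero hρ hζ (hone ζ hζ j) (hroot ζ hζ j)
  choose ψ hψζ hψd hψ0 using hmove
  have hcont (j : Fin n) : ContinuousAt (ψ j) ζ := (hψd j).choose_spec.2.continuousAt
  have hψmono : ∀ᶠ s in nhds ζ, StrictMono fun j => ψ j s := by
    simp only [StrictMono, Filter.eventually_all]
    refine fun i j hij => (hcont i).eventually_lt (hcont j) ?_
    rw [hψζ, hψζ]
    exact hmono ζ hζ hij
  have hψone : ∀ᶠ s in nhds ζ, ∀ j, 1 < ψ j s := Filter.eventually_all.2 fun j =>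
    (hcont j).eventually_const_lt (by rw [hψζ]; exact hone ζ hζ j)
  obtain ⟨d, hd, hder⟩ := hψd k
  refine ⟨d, hd, hder.congr_of_eventuallyEq ?_⟩
  filter_upwards [h.isOpen.mem_nhds hζ, hψmono, hψone, Filter.eventually_all.2 hψ0]
    with s hs hsmono hsone hs0
  have hπ := h.isMonicOrthogonal s hs
  have hL := h.isPositiveOn s hs
  have hrange : Set.range (g s) = Set.range fun j => ψ j s :=
    (hπ.range_eq_zeros_crossSum hL (hρ s hs) (hmono s hs) (hone s hs) (hroot s hs)).trans
      (hπ.range_eq_zeros_crossSum hL (hρ s hs) hsmono hsone hs0).symm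
  exact congrFun ((StrictMono.range_inj (hmono s hs) hsmono).1 hrange) k

end IsTodaDeformation

/-! ### Integration against exponential weights -/

section LaplaceFunctional

open MeasureTheory ProbabilityTheory

/-- The functional `p ↦ ∫ p(x) exp (-s x) dμ(x)`, defined through its moments so that it is linear
for every `s`; see `laplaceFunctional_apply` for the range of validity of the integral formula. -/
noncomputable def laplaceFunctional (μ : Measure ℝ) (s : ℝ) : ℝ[X] →ₗ[ℝ] ℝ :=
  lsum fun k => (∫ x, x ^ k * Real.exp (-s * x) ∂μ) • LinearMap.id

variable {μ : Measure ℝ} {s : ℝ}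

theorem laplaceFunctional_monomial (μ : Measure ℝ) (s : ℝ) (k : ℕ) (c : ℝ) :
    laplaceFunctional μ s (monomial k c) = (∫ x, x ^ k * Real.exp (-s * x) ∂μ) * c := by
  rw [laplaceFunctional, lsum_apply, sum_monomial_index _ _ (map_zero (_ • LinearMap.id))]
  rfl

theorem integrable_eval_mul_exp (hs : -s ∈ interior (integrableExpSet id μ)) (p : ℝ[X]) :
    Integrable (fun x => p.eval x * Real.exp (-s * x)) μ := by
  simp only [eval_eq_sum_range, Finset.sum_mul, mul_assoc]
  exact integrable_finsetSum _ fun k _ =>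
    (integrable_pow_mul_exp_of_mem_interior_integrableExpSet hs k).const_mul _

theorem laplaceFunctional_apply (hs : -s ∈ interior (integrableExpSet id μ)) (p : ℝ[X]) :
    laplaceFunctional μ s p = ∫ x, p.eval x * Real.exp (-s * x) ∂μ := by
  induction p using Polynomial.induction_on' with
  | add p q hp hq =>
    rw [map_add, hp, hq, ← integral_add (integrable_eval_mul_exp hs p)
      (integrable_eval_mul_exp hs q)]
    simp only [eval_add, add_mul]
  | monomial k c =>
    rw [laplaceFunctional_monomial, ← integral_mul_const]
    simp only [eval_monomial, mul_comm c, mul_right_comm]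

theorem isPositiveOn_laplaceFunctional [NullSingletonClass μ] [NeZero μ]
    (hs : -s ∈ interior (integrableExpSet id μ)) {S : Set ℝ} (hS : ∀ᵐ x ∂μ, x ∈ S) :
    IsPositiveOn (laplaceFunctional μ s) S := by
  intro p hp hpS
  have hnonneg : 0 ≤ᵐ[μ] fun x => p.eval x * Real.exp (-s * x) :=
    hS.mono fun x hx => mul_nonneg (hpS x hx) (Real.exp_pos _).le
  have hsupp : Function.support (fun x => p.eval x * Real.exp (-s * x))
      = ((p.roots.toFinset : Set ℝ))ᶜ := by
    ext x
    simp [hp, (Real.exp_pos _).ne']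
  have hroots : μ (p.roots.toFinset : Set ℝ) = 0 := p.roots.toFinset.measure_zero μ
  rw [laplaceFunctional_apply hs, integral_pos_iff_support_of_nonneg_ae hnonneg
    (integrable_eval_mul_exp hs p), hsupp, measure_compl (Finset.measurableSet _)
    (hroots.trans_ne ENNReal.zero_ne_top), hroots, tsub_zero]
  exact Measure.measure_univ_pos.2 (NeZero.ne μ)

theorem hasDerivAt_laplaceFunctional (hs : -s ∈ interior (integrableExpSet id μ)) (p : ℝ[X]) :
    HasDerivAt (fun t => laplaceFunctional μ t p) (-laplaceFunctional μ s (X * p)) s := by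
  induction p using Polynomial.induction_on' with
  | add p q hp hq =>
    simp only [mul_add, map_add, neg_add]
    exact hp.fun_add hq
  | monomial k c =>
    simp only [X_mul_monomial, laplaceFunctional_monomial]
    refine (((hasDerivAt_integral_pow_mul_exp_real hs k).comp s
      (hasDerivAt_neg s)).mul_const c).congr_deriv ?_
    simp

theorem isTodaDeformation_laplaceFunctional [NullSingletonClass μ] [NeZero μ] {S U : Set ℝ}
    {π : ℝ → ℕ → ℝ[X]} (hU : IsOpen U) (hμ : ∀ s ∈ U, -s ∈ interior (integrableExpSet id μ))
    (hS : ∀ᵐ x ∂μ, x ∈ S) (hπ : ∀ s ∈ U, IsMonicOrthogonal (laplaceFunctional μ s) (π s)) :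
    IsTodaDeformation (laplaceFunctional μ) π S U where
  isOpen := hU
  isPositiveOn s hs := isPositiveOn_laplaceFunctional (hμ s hs) hS
  isMonicOrthogonal := hπ
  hasDerivAt s hs := hasDerivAt_laplaceFunctional (hμ s hs)

end LaplaceFunctional

/-! ### The relativistic weights -/

section Weight

open MeasureTheory ProbabilityTheory

/-- The measure on `(1, ∞)` with density `(x² - 1)^(-1/2)`. Up to the factor `K_1(ζ)`, the weight
`ω^(ℓ)` is its Laplace density `exp (-ζ x)` multiplied by `(x² - 1)^ℓ`. -/
noncomputable def hyperbolicMeasure : Measure ℝ :=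
  (volume.restrict (Set.Ioi 1)).withDensity
    fun x => ENNReal.ofReal ((x ^ 2 - 1) ^ (-(1 / 2) : ℝ))

theorem hyperbolicMeasure_absolutelyContinuous :
    hyperbolicMeasure ≪ volume.restrict (Set.Ioi 1) :=
  withDensity_absolutelyContinuous _ _

theorem integral_hyperbolicMeasure (f : ℝ → ℝ) :
    ∫ x, f x ∂hyperbolicMeasure
      = ∫ x in Set.Ioi 1, (x ^ 2 - 1) ^ (-(1 / 2) : ℝ) * f x := by
  rw [hyperbolicMeasure, integral_withDensity_eq_integral_toReal_smul (by fun_prop) (by simp)]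
  refine setIntegral_congr_fun measurableSet_Ioi fun x hx => ?_
  have hx1 : 0 ≤ x ^ 2 - 1 := by nlinarith [Set.mem_Ioi.1 hx]
  simp only [smul_eq_mul]
  rw [ENNReal.toReal_ofReal (Real.rpow_nonneg hx1 _)]

theorem ae_hyperbolicMeasure : ∀ᵐ x ∂hyperbolicMeasure, x ∈ Set.Ioi (1 : ℝ) :=
  hyperbolicMeasure_absolutelyContinuous.ae_le (ae_restrict_mem measurableSet_Ioi)

instance : NullSingletonClass hyperbolicMeasure :=
  ⟨fun x => hyperbolicMeasure_absolutelyContinuous (measure_singleton x)⟩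

instance : NeZero hyperbolicMeasure := by
  refine ⟨fun h0 => ?_⟩
  rw [hyperbolicMeasure, withDensity_eq_zero_iff (by fun_prop)] at h0
  have hae : ∀ᵐ _ ∂volume.restrict (Set.Ioi (1 : ℝ)), False := by
    filter_upwards [h0, ae_restrict_mem measurableSet_Ioi] with x hx hx1
    have hsq : 0 < x ^ 2 - 1 := by nlinarith [Set.mem_Ioi.1 hx1]
    exact (ENNReal.ofReal_pos.2 (Real.rpow_pos_of_pos hsq _)).ne' hx
  rw [Filter.eventually_false_iff_eq_bot, ae_eq_bot, Measure.restrict_eq_zero,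
    Real.volume_Ioi] at hae
  exact ENNReal.top_ne_zero hae

theorem Iio_zero_subset_integrableExpSet_hyperbolicMeasure :
    Set.Iio 0 ⊆ integrableExpSet id hyperbolicMeasure := by
  intro t ht
  have hshift : IntegrableOn
      (fun x : ℝ => (x - 1) ^ (-(1 / 2) : ℝ) * Real.exp (t * (x - 1))) (Set.Ioi 1) := by
    have h0 : IntegrableOn (fun u : ℝ => u ^ (-(1 / 2) : ℝ) * Real.exp (- -t * u ^ (1 : ℝ)))
        (Set.Ioi 0) :=
      integrableOn_rpow_mul_exp_neg_mul_rpow (by norm_num) one_pos (neg_pos.2 ht)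
    have h1 := (integrable_indicator_iff measurableSet_Ioi).2 h0 |>.comp_sub_right 1
    rw [← integrable_indicator_iff measurableSet_Ioi]
    refine h1.congr (Filter.Eventually.of_forall fun x => ?_)
    by_cases hx : 1 < x <;> simp [Set.indicator, hx]
  rw [integrableExpSet, Set.mem_ofPred_eq, hyperbolicMeasure,
    integrable_withDensity_iff_integrable_smul' (by fun_prop) (by simp)]
  refine (hshift.mul_const (Real.exp t)).mono' (by fun_prop) ?_
  filter_upwards [ae_restrict_mem measurableSet_Ioi] with x hx
  have hx0 : 0 < x - 1 := sub_pos.2 hx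
  have hle : (x ^ 2 - 1) ^ (-(1 / 2) : ℝ) ≤ (x - 1) ^ (-(1 / 2) : ℝ) :=
    Real.rpow_le_rpow_of_nonpos hx0 (by nlinarith) (by norm_num)
  have hsq : 0 ≤ (x ^ 2 - 1) ^ (-(1 / 2) : ℝ) := Real.rpow_nonneg (by nlinarith) _
  rw [ENNReal.toReal_ofReal hsq, smul_eq_mul, Real.norm_of_nonneg (by positivity), mul_assoc,
    ← Real.exp_add, show t * (x - 1) + t = t * x by ring]
  exact mul_le_mul_of_nonneg_right hle (Real.exp_pos _).le

theorem neg_mem_interior_integrableExpSet_hyperbolicMeasure {ζ : ℝ} (hζ : 0 < ζ) :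
    -ζ ∈ interior (integrableExpSet id hyperbolicMeasure) :=
  interior_mono Iio_zero_subset_integrableExpSet_hyperbolicMeasure
    (by rw [interior_Iio]; exact neg_neg_of_pos hζ)

theorem isPositiveOn_laplaceFunctional_hyperbolicMeasure {ζ : ℝ} (hζ : 0 < ζ) :
    IsPositiveOn (laplaceFunctional hyperbolicMeasure ζ) (Set.Ici 1) :=
  isPositiveOn_laplaceFunctional (neg_mem_interior_integrableExpSet_hyperbolicMeasure hζ)
    (ae_hyperbolicMeasure.mono fun _ hx => (Set.mem_Ioi.1 hx).le)

theorem integrableOn_cosh_mul_exp_neg {ζ : ℝ} (hζ : 0 < ζ) :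
    IntegrableOn (fun θ => Real.cosh θ * Real.exp (-ζ * Real.cosh θ)) (Set.Ioi 0) := by
  have hderiv (θ : ℝ) : HasDerivAt (fun θ => -(Real.exp (-ζ * Real.sinh θ) / ζ))
      (Real.cosh θ * Real.exp (-ζ * Real.sinh θ)) θ := by
    refine (((Real.hasDerivAt_sinh θ).const_mul (-ζ)).exp.div_const ζ).neg.congr_deriv ?_
    field_simp
  have hlim : Filter.Tendsto (fun θ => -(Real.exp (-ζ * Real.sinh θ) / ζ)) Filter.atTop
      (nhds (-(0 / ζ))) :=
    ((Real.tendsto_exp_atBot.comp (Real.sinhOrderIso.tendsto_atTop.const_mul_atTop_of_neg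
      (neg_neg_of_pos hζ))).div_const ζ).neg
  refine (integrableOn_Ioi_deriv_of_nonneg' (fun θ _ => hderiv θ) (fun θ _ => ?_) hlim).mono'
    (by fun_prop) (Filter.Eventually.of_forall fun θ => ?_)
  · positivity
  · rw [Real.norm_of_nonneg (by positivity)]
    gcongr Real.cosh θ * Real.exp ?_
    nlinarith [Real.sinh_lt_cosh θ]

theorem besselK_one_pos {ζ : ℝ} (hζ : 0 < ζ) : 0 < besselK 1 ζ := by
  simp only [besselK, one_mul]
  have hpos (θ : ℝ) : 0 < Real.cosh θ * Real.exp (-ζ * Real.cosh θ) := by positivity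
  rw [setIntegral_pos_iff_support_of_nonneg_ae (Filter.Eventually.of_forall fun θ => (hpos θ).le)
    (integrableOn_cosh_mul_exp_neg hζ), Function.support_eq_univ fun θ => (hpos θ).ne',
    Set.univ_inter, Real.volume_Ioi]
  exact ENNReal.zero_lt_top

end Weight

/-- The functional `p ↦ ∫ p(x) ω^(ℓ)(x; ζ) dx`. -/
noncomputable def weightedIntegral (l : ℕ) (ζ : ℝ) : ℝ[X] →ₗ[ℝ] ℝ :=
  (besselK 1 ζ)⁻¹ • (laplaceFunctional hyperbolicMeasure ζ ∘ₗ LinearMap.mulLeft ℝ ((X ^ 2 - 1) ^ l))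

theorem weightedIntegral_apply (l : ℕ) (ζ : ℝ) (p : ℝ[X]) : weightedIntegral l ζ p
    = (besselK 1 ζ)⁻¹ * laplaceFunctional hyperbolicMeasure ζ ((X ^ 2 - 1) ^ l * p) :=
  rfl

theorem weightedIntegral_one_apply (ζ : ℝ) (p : ℝ[X]) :
    weightedIntegral 1 ζ p = weightedIntegral 0 ζ ((X ^ 2 - 1) * p) := by
  simp only [weightedIntegral_apply, pow_zero, pow_one, one_mul]

theorem IsMonicOrthogonal.of_forall_eq_mul {M : ℝ[X] →ₗ[ℝ] ℝ} (h : IsMonicOrthogonal L π) {c : ℝ}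
    (hM : ∀ p, M p = c * L p) : IsMonicOrthogonal M π where
  monic := h.monic
  natDegree_eq := h.natDegree_eq
  apply_mul_eq_zero n q hq := by rw [hM, h.apply_mul_eq_zero n q hq, mul_zero]

section WeightedIntegral

variable {ζ : ℝ}

theorem ip_eq_weightedIntegral (l : ℕ) (hζ : 0 < ζ) (f g : ℝ[X]) :
    ip l ζ f g = weightedIntegral l ζ (f * g) := by
  rw [weightedIntegral_apply, laplaceFunctional_apply
    (neg_mem_interior_integrableExpSet_hyperbolicMeasure hζ), integral_hyperbolicMeasure, ip,
    ← MeasureTheory.integral_const_mul]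
  refine MeasureTheory.setIntegral_congr_fun measurableSet_Ioi fun x hx => ?_
  have hsq : 0 < x ^ 2 - 1 := by nlinarith [Set.mem_Ioi.1 hx]
  simp only [weight, eval_mul, eval_pow, eval_sub, eval_X, eval_one]
  rw [sub_eq_add_neg (l : ℝ), Real.rpow_add hsq, Real.rpow_natCast]
  ring

theorem isPositiveOn_weightedIntegral (l : ℕ) (hζ : 0 < ζ) :
    IsPositiveOn (weightedIntegral l ζ) (Set.Ici 1) := by
  refine IsPositiveOn.smul ?_ (inv_pos.2 (besselK_one_pos hζ))
  refine (isPositiveOn_laplaceFunctional_hyperbolicMeasure hζ).comp_mulLeft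
    (pow_ne_zero l (X_pow_sub_C_ne_zero two_pos 1)) fun x hx => ?_
  have hsq : 0 ≤ x ^ 2 - 1 := by nlinarith [Set.mem_Ici.1 hx]
  simpa only [eval_pow, eval_sub, eval_X, eval_one] using pow_nonneg hsq l

theorem isMonicOrthogonal_monicOP (l : ℕ) (hζ : 0 < ζ) :
    IsMonicOrthogonal (weightedIntegral l ζ) (monicOP l ζ) := by
  have hGramSchmidt (n : ℕ) : monicOP l ζ n = X ^ n - ∑ k ∈ Finset.range n,
      C (weightedIntegral l ζ (X ^ n * monicOP l ζ k)
        / weightedIntegral l ζ (monicOP l ζ k * monicOP l ζ k)) * monicOP l ζ k := by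
    rw [monicOP, Finset.sum_range]
    simp_rw [ip_eq_weightedIntegral l hζ]
  refine isMonicOrthogonal_of_eq_X_pow_sub_sum (fun n => ?_) hGramSchmidt
  exact ((isPositiveOn_weightedIntegral l hζ).apply_mul_self_pos
    (monic_and_natDegree_eq_of_eq_X_pow_sub_sum hGramSchmidt n).1.ne_zero).ne'

theorem isMonicOrthogonal_laplaceFunctional_monicOP_zero (hζ : 0 < ζ) :
    IsMonicOrthogonal (laplaceFunctional hyperbolicMeasure ζ) (monicOP 0 ζ) :=
  (isMonicOrthogonal_monicOP 0 hζ).of_forall_eq_mul (c := besselK 1 ζ) fun p => by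
    rw [weightedIntegral_apply, mul_inv_cancel_left₀ (besselK_one_pos hζ).ne', pow_zero, one_mul]

theorem isMonicOrthogonal_laplaceFunctional_monicOP_one (hζ : 0 < ζ) :
    IsMonicOrthogonal (laplaceFunctional hyperbolicMeasure ζ ∘ₗ LinearMap.mulLeft ℝ (X ^ 2 - 1))
      (monicOP 1 ζ) :=
  (isMonicOrthogonal_monicOP 1 hζ).of_forall_eq_mul (c := besselK 1 ζ) fun p => by
    rw [weightedIntegral_apply, mul_inv_cancel_left₀ (besselK_one_pos hζ).ne', pow_one]
    rfl

theorem isTodaDeformation_laplaceFunctional_hyperbolicMeasure :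
    IsTodaDeformation (laplaceFunctional hyperbolicMeasure) (monicOP 0) (Set.Ici 1) (Set.Ioi 0) :=
  isTodaDeformation_laplaceFunctional isOpen_Ioi
    (fun _ hs => neg_mem_interior_integrableExpSet_hyperbolicMeasure hs)
    (ae_hyperbolicMeasure.mono fun _ hx => (Set.mem_Ioi.1 hx).le)
    fun _ hs => isMonicOrthogonal_laplaceFunctional_monicOP_zero hs

end WeightedIntegral

/-! ### Zeros of `Q` -/

section Zeros

variable {ζ : ℝ} {n : ℕ}

theorem inv_sqrt_ip_monicOP_pos (l : ℕ) (hζ : 0 < ζ) (n : ℕ) :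
    0 < (√(ip l ζ (monicOP l ζ n) (monicOP l ζ n)))⁻¹ := by
  rw [inv_pos, Real.sqrt_pos, ip_eq_weightedIntegral l hζ]
  exact (isMonicOrthogonal_monicOP l hζ).apply_mul_self_pos (isPositiveOn_weightedIntegral l hζ) n

theorem natDegree_P (l : ℕ) (hζ : 0 < ζ) (n : ℕ) : (P l ζ n).natDegree = n := by
  rw [P, natDegree_C_mul (inv_sqrt_ip_monicOP_pos l hζ n).ne',
    (isMonicOrthogonal_monicOP l hζ).natDegree_eq]

theorem exists_Q_eq_C_mul_crossSum (hζ : 0 < ζ) (n : ℕ) :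
    ∃ c : ℝ, c ≠ 0 ∧ Q ζ n = C c * crossSum (monicOP 0 ζ (n + 1)) (monicOP 1 ζ n) :=
  ⟨_, mul_ne_zero (inv_sqrt_ip_monicOP_pos 0 hζ (n + 1)).ne' (inv_sqrt_ip_monicOP_pos 1 hζ n).ne',
    crossSum_C_mul_C_mul _ _ _ _⟩

theorem Q_comp_neg_X (ζ : ℝ) (n : ℕ) : (Q ζ n).comp (-X) = Q ζ n :=
  crossSum_comp_neg_X _ _

theorem eval_Q_eq_zero_iff (hζ : 0 < ζ) {x : ℝ} :
    (Q ζ n).eval x = 0 ↔ (crossSum (monicOP 0 ζ (n + 1)) (monicOP 1 ζ n)).eval x = 0 := by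
  obtain ⟨c, hc, hQ⟩ := exists_Q_eq_C_mul_crossSum hζ n
  rw [hQ, eval_mul, eval_C, mul_eq_zero, or_iff_right hc]

theorem exists_strictMono_zeros_Q (n : ℕ) : ∃ g : ℝ → Fin n → ℝ, ∀ ζ, 0 < ζ →
    StrictMono (g ζ) ∧ ∀ k, 1 < g ζ k ∧ (Q ζ n).eval (g ζ k) = 0 := by
  have hex (ζ : ℝ) : ∃ g : Fin n → ℝ, 0 < ζ →
      StrictMono g ∧ ∀ k, 1 < g k ∧ (Q ζ n).eval (g k) = 0 := by
    by_cases hζ : 0 < ζ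
    · simpa only [hζ, forall_const, eval_Q_eq_zero_iff hζ] using
        (isMonicOrthogonal_laplaceFunctional_monicOP_zero hζ).exists_strictMono_zeros_crossSum
          (isPositiveOn_laplaceFunctional_hyperbolicMeasure hζ)
          (isMonicOrthogonal_laplaceFunctional_monicOP_one hζ) n
    · exact ⟨0, fun h => absurd h hζ⟩
  choose g hg using hex
  exact ⟨g, hg⟩

/-- The zeros of `Q ζ n` in `(1, ∞)`, in increasing order. -/
noncomputable def posZero (n : ℕ) : ℝ → Fin n → ℝ := (exists_strictMono_zeros_Q n).choose

theorem posZero_strictMono (hζ : 0 < ζ) : StrictMono (posZero n ζ) :=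
  ((exists_strictMono_zeros_Q n).choose_spec ζ hζ).1

theorem one_lt_posZero (hζ : 0 < ζ) (k : Fin n) : 1 < posZero n ζ k :=
  (((exists_strictMono_zeros_Q n).choose_spec ζ hζ).2 k).1

theorem posZero_pos (hζ : 0 < ζ) (k : Fin n) : 0 < posZero n ζ k :=
  one_pos.trans (one_lt_posZero hζ k)

theorem eval_Q_posZero (hζ : 0 < ζ) (k : Fin n) : (Q ζ n).eval (posZero n ζ k) = 0 :=
  (((exists_strictMono_zeros_Q n).choose_spec ζ hζ).2 k).2

theorem exists_hasDerivAt_posZero (hζ : 0 < ζ) (k : Fin n) :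
    ∃ d < 0, HasDerivAt (fun s => posZero n s k) d ζ :=
  isTodaDeformation_laplaceFunctional_hyperbolicMeasure.exists_hasDerivAt_zeros
    (fun _ hs => isMonicOrthogonal_laplaceFunctional_monicOP_one hs)
    (fun _ hs => posZero_strictMono hs) (fun _ hs => one_lt_posZero hs)
    (fun _ hs k => (eval_Q_eq_zero_iff hs).1 (eval_Q_posZero hs k)) hζ k

/-- The zeros `z_{i,n}(ζ)` of `Q ζ n`, labelled by `idx n` in increasing order. -/
noncomputable def zeroAt (n : ℕ) (i : ℤ) (ζ : ℝ) : ℝ := oddExtend (posZero n ζ) i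

theorem zeroAt_neg (n : ℕ) (i : ℤ) (ζ : ℝ) : zeroAt n (-i) ζ = -zeroAt n i ζ :=
  oddExtend_neg _ _

theorem one_lt_zeroAt (hζ : 0 < ζ) {i : ℤ} (hi : i ∈ idx n) (hpos : 0 < i) : 1 < zeroAt n i ζ :=
  lt_oddExtend (one_lt_posZero hζ) hi hpos

theorem zeroAt_strictMonoOn (hζ : 0 < ζ) : StrictMonoOn (fun i => zeroAt n i ζ) (idx n) :=
  oddExtend_strictMonoOn (posZero_strictMono hζ) (posZero_pos hζ)

theorem one_lt_sq_zeroAt (hζ : 0 < ζ) {i : ℤ} (hi : i ∈ idx n) : 1 < zeroAt n i ζ ^ 2 := by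
  rcases hi.1.lt_or_gt with hneg | hpos
  · rw [← neg_sq, ← zeroAt_neg]
    exact one_lt_pow₀ (one_lt_zeroAt hζ (neg_mem_idx hi) (neg_pos.2 hneg)) two_ne_zero
  · exact one_lt_pow₀ (one_lt_zeroAt hζ hi hpos) two_ne_zero

theorem Q_ne_zero (hζ : 0 < ζ) (n : ℕ) : Q ζ n ≠ 0 := by
  obtain ⟨c, hc, hQ⟩ := exists_Q_eq_C_mul_crossSum hζ n
  rw [hQ]
  exact mul_ne_zero (C_ne_zero.2 hc)
    ((isMonicOrthogonal_laplaceFunctional_monicOP_zero hζ).crossSum_ne_zero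
      (isPositiveOn_laplaceFunctional_hyperbolicMeasure hζ)
      (isMonicOrthogonal_laplaceFunctional_monicOP_one hζ) n)

theorem natDegree_Q_le (hζ : 0 < ζ) (n : ℕ) : (Q ζ n).natDegree ≤ 2 * n :=
  natDegree_crossSum_le (natDegree_P 0 hζ _).le (natDegree_P 1 hζ _).le

theorem natDegree_Q (hζ : 0 < ζ) (n : ℕ) : (Q ζ n).natDegree = 2 * n :=
  natDegree_eq_of_strictMono_zeros (Q_ne_zero hζ n) (Q_comp_neg_X ζ n) (natDegree_Q_le hζ n)
    (posZero_strictMono hζ) (posZero_pos hζ) (eval_Q_posZero hζ)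

theorem roots_Q (hζ : 0 < ζ) (n : ℕ) :
    (Q ζ n).roots = ((labels n).image fun i => zeroAt n i ζ).val :=
  roots_eq_image_oddExtend (Q_ne_zero hζ n) (Q_comp_neg_X ζ n) (natDegree_Q_le hζ n)
    (posZero_strictMono hζ) (posZero_pos hζ) (eval_Q_posZero hζ)

theorem isRoot_Q_iff (hζ : 0 < ζ) {x : ℝ} : (Q ζ n).IsRoot x ↔ ∃ i ∈ idx n, x = zeroAt n i ζ := by
  simp only [← mem_roots (Q_ne_zero hζ n), roots_Q hζ, Finset.mem_val, Finset.mem_image,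
    mem_labels, eq_comm]

theorem rootMultiplicity_Q (hζ : 0 < ζ) {i : ℤ} (hi : i ∈ idx n) :
    (Q ζ n).rootMultiplicity (zeroAt n i ζ) = 1 := by
  rw [← count_roots, roots_Q hζ]
  exact Multiset.count_eq_one_of_mem (Finset.nodup _)
    (Finset.mem_image_of_mem _ (mem_labels.2 hi))

end Zeros

/-! ### Regular matrix pencils -/

section Pencil

variable {K F ι : Type*} [Field K] [Field F] [Fintype ι] [DecidableEq ι] {A B : Matrix ι ι K}

theorem map_pencilPoly (f : K →+* F) (A B : Matrix ι ι K) :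
    (pencilPoly A B).map f = pencilPoly (A.map f) (B.map f) := by
  rw [pencilPoly, pencilPoly, ← coe_mapRingHom, RingHom.map_det]
  congr 1
  ext1 i j
  simp

theorem eval_pencilPoly (A B : Matrix ι ι K) (μ : K) :
    (pencilPoly A B).eval μ = (μ • A - B).det := by
  rw [pencilPoly, ← coe_evalRingHom, RingHom.map_det]
  congr 1
  ext1 i j
  simp [mul_comm μ]

theorem isRoot_pencilPoly_iff {μ : K} : (pencilPoly A B).IsRoot μ ↔ IsGenEigenvalue A B μ := by
  simp only [IsRoot, eval_pencilPoly, ← Matrix.exists_mulVec_eq_zero_iff, IsGenEigenvalue,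
    Matrix.sub_mulVec, Matrix.smul_mulVec, sub_eq_zero, eq_comm (a := μ • _)]

theorem pencilPoly_eq_C_mul_charpoly (hA : A.det ≠ 0) (B : Matrix ι ι K) :
    pencilPoly A B = C A.det * (A⁻¹ * B).charpoly := by
  have hfactor : A.map C * (A⁻¹ * B).charmatrix = (X : K[X]) • A.map C - B.map C := by
    rw [Matrix.charmatrix, mul_sub, RingHom.mapMatrix_apply, ← Matrix.map_mul,
      Matrix.mul_nonsing_inv_cancel_left _ _ (isUnit_iff_ne_zero.2 hA), Matrix.scalar_apply,
      ← Matrix.smul_one_eq_diagonal, Matrix.mul_smul, Matrix.mul_one]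
  rw [pencilPoly, ← hfactor, Matrix.det_mul, Matrix.charpoly, RingHom.map_det C A,
    RingHom.mapMatrix_apply]

theorem pencilPoly_ne_zero (hA : A.det ≠ 0) (B : Matrix ι ι K) : pencilPoly A B ≠ 0 := by
  rw [pencilPoly_eq_C_mul_charpoly hA]
  exact mul_ne_zero (C_ne_zero.2 hA) (Matrix.charpoly_monic _).ne_zero

theorem natDegree_pencilPoly (hA : A.det ≠ 0) (B : Matrix ι ι K) :
    (pencilPoly A B).natDegree = Fintype.card ι := by
  rw [pencilPoly_eq_C_mul_charpoly hA, natDegree_C_mul hA, Matrix.charpoly_natDegree_eq_dim]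

theorem roots_pencilPoly (hA : A.det ≠ 0) {Λ : Finset K} (hcard : Λ.card = Fintype.card ι)
    (hΛ : ∀ μ ∈ Λ, IsGenEigenvalue A B μ) : (pencilPoly A B).roots = Λ.val :=
  roots_eq_of_natDegree_le_card_of_ne_zero (fun μ hμ => isRoot_pencilPoly_iff.2 (hΛ μ hμ))
    (by rw [natDegree_pencilPoly hA, hcard]) (pencilPoly_ne_zero hA B)

theorem rootMultiplicity_pencilPoly (hA : A.det ≠ 0) {Λ : Finset K}
    (hcard : Λ.card = Fintype.card ι) (hΛ : ∀ μ ∈ Λ, IsGenEigenvalue A B μ) {μ : K} (hμ : μ ∈ Λ) :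
    (pencilPoly A B).rootMultiplicity μ = 1 := by
  classical
  rw [← count_roots, roots_pencilPoly hA hcard hΛ]
  exact Multiset.count_eq_one_of_mem Λ.nodup hμ

theorem isGenEigenvalue_map_iff (f : K →+* F) (hA : A.det ≠ 0) {Λ : Finset K}
    (hcard : Λ.card = Fintype.card ι) (hΛ : ∀ μ ∈ Λ, IsGenEigenvalue A B μ) {μ : F} :
    IsGenEigenvalue (A.map f) (B.map f) μ ↔ ∃ x ∈ Λ, f x = μ := by
  have hroots := roots_pencilPoly hA hcard hΛ
  have hsplits : (pencilPoly A B).Splits := by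
    rw [splits_iff_card_roots, hroots, natDegree_pencilPoly hA, Finset.card_val, hcard]
  have hne : (pencilPoly A B).map f ≠ 0 := Polynomial.map_ne_zero (pencilPoly_ne_zero hA B)
  rw [← isRoot_pencilPoly_iff, ← map_pencilPoly, ← mem_roots hne, hsplits.roots_map, hroots,
    Multiset.mem_map]
  simp only [Finset.mem_val]

theorem mulVec_eq_smul_mulVec_iff_mem_eigenspace (hA : A.det ≠ 0) {μ : K} {w : ι → K} :
    B.mulVec w = μ • A.mulVec w ↔ w ∈ Module.End.eigenspace (A⁻¹ * B).toLin' μ := by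
  have hunit : IsUnit A.det := isUnit_iff_ne_zero.2 hA
  rw [Module.End.mem_eigenspace_iff, Matrix.toLin'_apply, ← Matrix.mulVec_mulVec]
  constructor <;> intro h
  · rw [h, Matrix.mulVec_smul, Matrix.mulVec_mulVec, Matrix.nonsing_inv_mul _ hunit,
      Matrix.one_mulVec]
  · rw [← Matrix.mulVec_smul, ← h, Matrix.mulVec_mulVec, Matrix.mul_nonsing_inv _ hunit,
      Matrix.one_mulVec]

theorem mulVec_eq_smul_mulVec_iff (hA : A.det ≠ 0) {μ : K}
    (hμ : (pencilPoly A B).rootMultiplicity μ = 1) {y : ι → K} (hy : y ≠ 0)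
    (hBy : B.mulVec y = μ • A.mulVec y) {w : ι → K} :
    B.mulVec w = μ • A.mulVec w ↔ ∃ c : K, w = c • y := by
  classical
  rw [mulVec_eq_smul_mulVec_iff_mem_eigenspace hA] at hBy ⊢
  refine ⟨fun hw => ?_, ?_⟩
  · have hmult : ((A⁻¹ * B).toLin').charpoly.rootMultiplicity μ = 1 := by
      rw [Matrix.charpoly_toLin', ← hμ, pencilPoly_eq_C_mul_charpoly hA, ← count_roots,
        ← count_roots, roots_C_mul _ hA]
    have hrank : Module.finrank K (Module.End.eigenspace (A⁻¹ * B).toLin' μ) = 1 :=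
      le_antisymm (hmult ▸ LinearMap.finrank_eigenspace_le (A⁻¹ * B).toLin' μ)
        (Module.finrank_pos_iff_exists_ne_zero.2 ⟨⟨y, hBy⟩, Subtype.coe_ne_coe.1 hy⟩)
    obtain ⟨c, hc⟩ := exists_smul_eq_of_finrank_eq_one hrank (x := ⟨y, hBy⟩)
      (Subtype.coe_ne_coe.1 hy) ⟨w, hw⟩
    exact ⟨c, (congrArg Subtype.val hc).symm⟩
  · rintro ⟨c, rfl⟩
    exact Submodule.smul_mem _ c hBy

end Pencil

/-! ### Orthonormal polynomials -/

/-- The sequence `φ` is orthonormal for `L`, with `φ n` of degree `n`. The sign of the leading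
coefficients is left free. -/
structure IsOrthonormal {K : Type*} [Field K] (L : K[X] →ₗ[K] K) (φ : ℕ → K[X]) : Prop where
  natDegree_eq : ∀ n, (φ n).natDegree = n
  apply_mul_eq_zero : ∀ (n : ℕ) (q : K[X]), q.degree < n → L (φ n * q) = 0
  apply_mul_self : ∀ n, L (φ n * φ n) = 1

section Coeff

variable {K : Type*} [Field K]

theorem coeff_eq_neg_leadingCoeff_mul_sum_roots {f : K[X]} (hf : f.Splits) {n : ℕ}
    (hn : f.natDegree = n + 1) : f.coeff n = -(f.leadingCoeff * f.roots.sum) := by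
  have hnext := hf.nextCoeff_eq_neg_sum_roots_mul_leadingCoeff
  rw [nextCoeff_of_natDegree_pos (by omega), hn, Nat.add_sub_cancel] at hnext
  rw [hnext]
  ring

theorem splits_X_sq_sub_one : (X ^ 2 - 1 : K[X]).Splits := by
  rw [show (X ^ 2 - 1 : K[X]) = (X - C 1) * (X - C (-1)) by simp; ring]
  exact (Splits.X_sub_C 1).mul (Splits.X_sub_C (-1))

theorem sum_roots_X_sq_sub_one : (X ^ 2 - 1 : K[X]).roots.sum = 0 := by
  rw [show (X ^ 2 - 1 : K[X]) = (X - C 1) * (X - C (-1)) by simp; ring,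
    roots_mul (mul_ne_zero (X_sub_C_ne_zero 1) (X_sub_C_ne_zero (-1))), roots_X_sub_C,
    roots_X_sub_C, Multiset.sum_add, Multiset.sum_singleton, Multiset.sum_singleton,
    add_neg_cancel]

theorem natDegree_X_sq_sub_one_mul {f : K[X]} (hf : f ≠ 0) :
    ((X ^ 2 - 1) * f).natDegree = f.natDegree + 2 := by
  rw [← C_1, natDegree_mul (X_pow_sub_C_ne_zero two_pos 1) hf, natDegree_X_pow_sub_C, add_comm]

theorem leadingCoeff_X_sq_sub_one_mul (f : K[X]) :
    ((X ^ 2 - 1) * f).leadingCoeff = f.leadingCoeff := by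
  rw [leadingCoeff_mul, ← C_1, leadingCoeff_X_pow_sub_C two_pos, one_mul]

end Coeff

namespace IsOrthonormal

variable {K : Type*} [Field K] {L : K[X] →ₗ[K] K} {φ : ℕ → K[X]}

theorem ne_zero (h : IsOrthonormal L φ) (n : ℕ) : φ n ≠ 0 := fun h0 => by
  simpa [h0] using h.apply_mul_self n

theorem degree_eq (h : IsOrthonormal L φ) (n : ℕ) : (φ n).degree = n := by
  rw [degree_eq_natDegree (h.ne_zero n), h.natDegree_eq]

theorem linearIndependent (h : IsOrthonormal L φ) : LinearIndependent K φ :=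
  Sequence.linearIndependent ⟨φ, h.degree_eq⟩

theorem isMonicOrthogonal (h : IsOrthonormal L φ) :
    IsMonicOrthogonal L fun n => (φ n).leadingCoeff⁻¹ • φ n where
  monic n := by
    rw [smul_eq_C_mul]
    exact monic_C_mul_of_mul_leadingCoeff_eq_one
      (inv_mul_cancel₀ (leadingCoeff_ne_zero.2 (h.ne_zero n)))
  natDegree_eq n := by
    rw [natDegree_smul _ (inv_ne_zero (leadingCoeff_ne_zero.2 (h.ne_zero n))), h.natDegree_eq]
  apply_mul_eq_zero n q hq := by
    rw [smul_mul_assoc, map_smul, h.apply_mul_eq_zero n q hq, smul_zero]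

theorem apply_mul (h : IsOrthonormal L φ) {n : ℕ} {f : K[X]} (hf : f.natDegree ≤ n) :
    L (φ n * f) = f.coeff n / (φ n).leadingCoeff := by
  have hlc := leadingCoeff_ne_zero.2 (h.ne_zero n)
  have hmonic := h.isMonicOrthogonal.apply_mul hf
  simp only [smul_mul_assoc, mul_smul_comm, map_smul, h.apply_mul_self, smul_eq_mul,
    mul_one] at hmonic
  field_simp at hmonic
  rw [eq_div_iff hlc, mul_comm, hmonic]

theorem apply_mul_of_splits (h : IsOrthonormal L φ) {n : ℕ} (hφ : (φ (n + 1)).Splits) {f : K[X]}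
    (hf : f.natDegree = n + 1) (hfs : f.Splits) : L (φ n * f)
      = f.leadingCoeff / (φ n).leadingCoeff * ((φ (n + 1)).roots.sum - f.roots.sum) := by
  have hlc := leadingCoeff_ne_zero.2 (h.ne_zero (n + 1))
  set ψ := (φ (n + 1)).leadingCoeff⁻¹ • φ (n + 1) with hψ
  have hlt : (f - C (f.coeff (n + 1)) * ψ).degree < ((n + 1 : ℕ) : WithBot ℕ) :=
    degree_sub_C_coeff_mul_lt (h.isMonicOrthogonal.monic (n + 1))
      (h.isMonicOrthogonal.natDegree_eq (n + 1)) (degree_lt_succ_of_natDegree_le hf.le)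
  have hlow : (f - C (f.coeff (n + 1)) * ψ).natDegree ≤ n :=
    natDegree_le_iff_coeff_eq_zero.2 ((degree_lt_iff_coeff_zero _ _).1 hlt)
  have hL : L (φ n * f) = L (φ n * (f - C (f.coeff (n + 1)) * ψ)) := by
    have h0 : L (φ n * φ (n + 1)) = 0 := by
      rw [mul_comm, h.apply_mul_eq_zero (n + 1) _
        (by rw [h.degree_eq]; exact_mod_cast n.lt_succ_self)]
    rw [mul_sub, map_sub, mul_left_comm, ← smul_eq_C_mul, map_smul, hψ, mul_smul_comm, map_smul,
      h0, smul_zero, smul_zero, sub_zero]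
  rw [hL, h.apply_mul hlow, coeff_sub, coeff_C_mul, hψ, coeff_smul, smul_eq_mul,
    coeff_eq_neg_leadingCoeff_mul_sum_roots hfs hf,
    coeff_eq_neg_leadingCoeff_mul_sum_roots hφ (h.natDegree_eq _), leadingCoeff, hf]
  field_simp
  ring

theorem eq_sum (h : IsOrthonormal L φ) {m : ℕ} {f : K[X]} (hf : f.degree < m) :
    f = ∑ k ∈ Finset.range m, C (L (f * φ k)) * φ k := by
  have hlc k := leadingCoeff_ne_zero.2 (h.ne_zero k)
  have hself (k : ℕ) : L (((φ k).leadingCoeff⁻¹ • φ k) * ((φ k).leadingCoeff⁻¹ • φ k))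
      = (φ k).leadingCoeff⁻¹ * (φ k).leadingCoeff⁻¹ := by
    simp only [smul_mul_assoc, mul_smul_comm, map_smul, h.apply_mul_self, smul_eq_mul, mul_one]
  conv_lhs => rw [h.isMonicOrthogonal.eq_sum (fun k => by
    rw [hself]; exact mul_self_ne_zero.2 (inv_ne_zero (hlc k))) hf]
  refine Finset.sum_congr rfl fun k _ => ?_
  rw [hself, ← smul_eq_C_mul, ← smul_eq_C_mul, smul_smul, mul_smul_comm, map_smul, smul_eq_mul]
  congr 1
  field_simp [hlc k]

theorem sum_apply_mul_mul_eval (h : IsOrthonormal L φ) {m : ℕ} {f : K[X]}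
    (hf : f.natDegree ≤ m) (x : K) : ∑ k : Fin m, L (f * φ k) * (φ k).eval x
      = f.eval x - L (f * φ m) * (φ m).eval x := by
  rw [eq_sub_iff_add_eq, ← Finset.sum_range fun k => L (f * φ k) * (φ k).eval x,
    ← Finset.sum_range_succ]
  conv_rhs => rw [h.eq_sum (degree_lt_succ_of_natDegree_le hf)]
  simp only [eval_finsetSum, eval_mul, eval_C]

end IsOrthonormal

/-! ### The matrices `A0` and `A1` -/

section Entries

variable {ζ : ℝ}

theorem isOrthonormal_P (l : ℕ) (hζ : 0 < ζ) : IsOrthonormal (weightedIntegral l ζ) (P l ζ) where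
  natDegree_eq := natDegree_P l hζ
  apply_mul_eq_zero n q hq := by
    rw [P, mul_assoc, ← smul_eq_C_mul, map_smul,
      (isMonicOrthogonal_monicOP l hζ).apply_mul_eq_zero n q hq, smul_zero]
  apply_mul_self n := by
    have hpos := (isMonicOrthogonal_monicOP l hζ).apply_mul_self_pos
      (isPositiveOn_weightedIntegral l hζ) n
    rw [P, ip_eq_weightedIntegral l hζ, mul_mul_mul_comm, ← C_mul, ← smul_eq_C_mul, map_smul,
      smul_eq_mul, ← mul_inv, Real.mul_self_sqrt hpos.le, inv_mul_cancel₀ hpos.ne']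

theorem splits_P (l : ℕ) (hζ : 0 < ζ) (n : ℕ) : (P l ζ n).Splits :=
  ((isMonicOrthogonal_monicOP l hζ).splits (isPositiveOn_weightedIntegral l hζ) n).C_mul _

theorem natDegree_X_mul_P_le (l : ℕ) (hζ : 0 < ζ) (n : ℕ) : (X * P l ζ n).natDegree ≤ n + 1 :=
  natDegree_X_mul_le (natDegree_P l hζ n).le

theorem natDegree_X_sq_sub_one_mul_P (l : ℕ) (hζ : 0 < ζ) (n : ℕ) :
    ((X ^ 2 - 1) * P l ζ n).natDegree = n + 2 := by
  rw [natDegree_X_sq_sub_one_mul ((isOrthonormal_P l hζ).ne_zero n), natDegree_P l hζ]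

theorem weightedIntegral_X_mul_P_mul_P_eq_zero (l : ℕ) (hζ : 0 < ζ) {i j : ℕ} (hij : i + 1 < j) :
    weightedIntegral l ζ (X * P l ζ i * P l ζ j) = 0 := by
  rw [mul_comm, (isOrthonormal_P l hζ).apply_mul_eq_zero]
  refine degree_le_natDegree.trans_lt ?_
  exact_mod_cast (natDegree_X_mul_P_le l hζ i).trans_lt hij

theorem jacobi_apply (l : ℕ) (hζ : 0 < ζ) {m : ℕ} (i j : Fin m) :
    jacobi l ζ m i j = weightedIntegral l ζ (X * P l ζ i * P l ζ j) := by
  have hsymm (i j : ℕ) : X * P l ζ i * P l ζ j = X * P l ζ j * P l ζ i := by ring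
  rw [jacobi, Matrix.of_apply]
  split_ifs with hdiag hsuper hsub
  · rw [hdiag, bCoef, ip_eq_weightedIntegral l hζ]
  · rw [hsuper, aCoef, ip_eq_weightedIntegral l hζ]
  · rw [hsub, aCoef, ip_eq_weightedIntegral l hζ, hsymm]
  · rcases lt_or_gt_of_ne (Fin.val_ne_of_ne hdiag) with hlt | hlt
    · rw [weightedIntegral_X_mul_P_mul_P_eq_zero l hζ (by omega)]
    · rw [hsymm, weightedIntegral_X_mul_P_mul_P_eq_zero l hζ (by omega)]

theorem weightedIntegral_one_P_mul_P (ζ : ℝ) (i j : ℕ) :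
    weightedIntegral 1 ζ (P 1 ζ i * P 0 ζ j)
      = weightedIntegral 0 ζ (P 0 ζ j * ((X ^ 2 - 1) * P 1 ζ i)) := by
  rw [weightedIntegral_one_apply, ← mul_assoc, mul_comm]

theorem pCoef_eq (hζ : 0 < ζ) (k : ℕ) :
    pCoef ζ k = weightedIntegral 1 ζ (P 1 ζ k * P 0 ζ k) := by
  rw [(isOrthonormal_P 1 hζ).apply_mul (natDegree_P 0 hζ k).le, pCoef, lc, lc, leadingCoeff,
    natDegree_P 0 hζ]

theorem qCoef_eq (hζ : 0 < ζ) (k : ℕ) :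
    qCoef ζ k = weightedIntegral 1 ζ (P 1 ζ k * P 0 ζ (k + 1)) := by
  have hne : (X ^ 2 - 1) * P 1 ζ k ≠ 0 :=
    mul_ne_zero (X_pow_sub_C_ne_zero two_pos 1) ((isOrthonormal_P 1 hζ).ne_zero k)
  rw [weightedIntegral_one_P_mul_P, (isOrthonormal_P 0 hζ).apply_mul_of_splits
      (splits_P 0 hζ (k + 2)) (natDegree_X_sq_sub_one_mul_P 1 hζ k)
      (splits_X_sq_sub_one.mul (splits_P 1 hζ k)),
    leadingCoeff_X_sq_sub_one_mul, roots_mul hne, Multiset.sum_add, sum_roots_X_sq_sub_one,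
    zero_add]
  rfl

theorem rCoef_succ_eq (hζ : 0 < ζ) (k : ℕ) :
    rCoef ζ (k + 1) = weightedIntegral 1 ζ (P 1 ζ k * P 0 ζ (k + 2)) := by
  have hdeg := natDegree_X_sq_sub_one_mul_P 1 hζ k
  rw [weightedIntegral_one_P_mul_P, (isOrthonormal_P 0 hζ).apply_mul hdeg.le, rCoef,
    Nat.add_sub_cancel, lc, lc, ← leadingCoeff_X_sq_sub_one_mul, leadingCoeff, hdeg]

theorem mixed_apply (hζ : 0 < ζ) {m : ℕ} (i : Fin m) (j : Fin (m + 1)) :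
    mixed ζ m i j = weightedIntegral 1 ζ (P 1 ζ i * P 0 ζ j) := by
  rw [mixed, Matrix.of_apply]
  split_ifs with hdiag hsuper hsuper₂
  · rw [hdiag, pCoef_eq hζ]
  · rw [hsuper, qCoef_eq hζ]
  · rw [hsuper₂, rCoef_succ_eq hζ]
  · rcases lt_or_gt_of_ne hdiag with hlt | hlt
    · rw [(isOrthonormal_P 1 hζ).apply_mul_eq_zero]
      rw [(isOrthonormal_P 0 hζ).degree_eq]
      exact_mod_cast hlt
    · rw [weightedIntegral_one_P_mul_P, (isOrthonormal_P 0 hζ).apply_mul_eq_zero]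
      refine degree_le_natDegree.trans_lt ?_
      rw [natDegree_X_sq_sub_one_mul_P 1 hζ]
      exact_mod_cast (by omega : (i : ℕ) + 2 < j)

theorem jacobi_mulVec_Pvec (l : ℕ) (hζ : 0 < ζ) {m : ℕ} (x : ℝ) (i : Fin m) :
    (jacobi l ζ m).mulVec (Pvec l ζ m x) i = x * (P l ζ i).eval x
      - weightedIntegral l ζ (X * P l ζ i * P l ζ m) * (P l ζ m).eval x := by
  simp only [Matrix.mulVec, dotProduct, jacobi_apply l hζ, Pvec]
  rw [(isOrthonormal_P l hζ).sum_apply_mul_mul_eval ((natDegree_X_mul_P_le l hζ i).trans i.2),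
    eval_mul, eval_X]

theorem mixed_mulVec_Pvec (hζ : 0 < ζ) {m : ℕ} (x : ℝ) (i : Fin m) :
    (mixed ζ m).mulVec (Pvec 0 ζ (m + 1) x) i = (x ^ 2 - 1) * (P 1 ζ i).eval x
      - weightedIntegral 1 ζ (P 1 ζ i * P 0 ζ (m + 1)) * (P 0 ζ (m + 1)).eval x := by
  have hdeg : ((X ^ 2 - 1) * P 1 ζ i).natDegree ≤ m + 1 := by
    rw [natDegree_X_sq_sub_one_mul_P 1 hζ]
    omega
  simp only [Matrix.mulVec, dotProduct, mixed_apply hζ, Pvec, weightedIntegral_one_P_mul_P,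
    mul_comm (P 0 ζ _)]
  rw [(isOrthonormal_P 0 hζ).sum_apply_mul_mul_eval hdeg]
  simp only [eval_mul, eval_sub, eval_pow, eval_X, eval_one]

theorem mixed_transpose_mulVec_Pvec (hζ : 0 < ζ) {m : ℕ} (x : ℝ) (j : Fin (m + 1)) :
    (mixed ζ m).transpose.mulVec (Pvec 1 ζ m x) j = (P 0 ζ j).eval x
      - weightedIntegral 1 ζ (P 1 ζ m * P 0 ζ j) * (P 1 ζ m).eval x := by
  simp only [Matrix.mulVec, dotProduct, Matrix.transpose_apply, mixed_apply hζ, Pvec,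
    mul_comm (P 1 ζ _)]
  exact (isOrthonormal_P 1 hζ).sum_apply_mul_mul_eval
    ((natDegree_P 0 hζ j).trans_le (Nat.lt_succ_iff.1 j.2)) x

theorem det_jacobi_ne_zero (l : ℕ) (hζ : 0 < ζ) (m : ℕ) : (jacobi l ζ m).det ≠ 0 := by
  have hpos : IsPositiveOn (weightedIntegral l ζ ∘ₗ LinearMap.mulLeft ℝ X) (Set.Ici 1) :=
    (isPositiveOn_weightedIntegral l hζ).comp_mulLeft X_ne_zero fun x hx => by
      rw [eval_X]
      exact zero_le_one.trans hx
  have hgram : jacobi l ζ m = Matrix.of fun i j : Fin m =>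
      (weightedIntegral l ζ ∘ₗ LinearMap.mulLeft ℝ X) (P l ζ i * P l ζ j) := by
    ext i j
    rw [jacobi_apply l hζ, mul_assoc]
    rfl
  rw [hgram]
  exact hpos.det_gram_ne_zero ((isOrthonormal_P l hζ).linearIndependent.comp _ Fin.val_injective)

theorem det_A0_ne_zero (hζ : 0 < ζ) (n : ℕ) : (A0 ζ n).det ≠ 0 := by
  rw [A0, Matrix.det_fromBlocks_zero₂₁]
  exact mul_ne_zero (det_jacobi_ne_zero 0 hζ _) (det_jacobi_ne_zero 1 hζ _)

end Entries

/-! ### The eigenvectors -/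

section Eigenvectors

variable {ζ : ℝ} {n : ℕ}

theorem A1_mulVec_yVec (hζ : 0 < ζ) {z : ℝ} (hz : 1 < z ^ 2) (hQ : (Q ζ n).eval z = 0) :
    (A1 ζ n).mulVec (yVec ζ n z) = lamHat z • (A0 ζ n).mulVec (yVec ζ n z) := by
  have hz0 : z ≠ 0 := fun h0 => by norm_num [h0] at hz
  have hsqrt : √(z ^ 2 - 1) * √(z ^ 2 - 1) = z ^ 2 - 1 := Real.mul_self_sqrt (by linarith)
  simp only [Q, eval_add, eval_mul, eval_comp, eval_neg, eval_X] at hQ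
  simp only [A0, A1, yVec, Matrix.fromBlocks_mulVec, lamHat, Sum.elim_comp_inl, Sum.elim_comp_inr,
    Matrix.zero_mulVec, zero_add, add_zero]
  ext (i | i)
  · simp only [Pi.smul_apply, Sum.elim_inl, smul_eq_mul, uVec, vVec, Matrix.mulVec_smul,
      Matrix.mulVec_add, Matrix.mulVec_sub, Pi.add_apply, Pi.sub_apply,
      mixed_transpose_mulVec_Pvec hζ, jacobi_mulVec_Pvec 0 hζ]
    field_simp
    linear_combination
      √(z ^ 2 - 1) * weightedIntegral 0 ζ (X * P 0 ζ i * P 0 ζ (n + 1)) * hQ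
  · simp only [Pi.smul_apply, Sum.elim_inr, smul_eq_mul, uVec, vVec, Matrix.mulVec_smul,
      Matrix.mulVec_add, Matrix.mulVec_sub, Pi.add_apply, Pi.sub_apply,
      mixed_mulVec_Pvec hζ, jacobi_mulVec_Pvec 1 hζ]
    field_simp
    linear_combination (-z * weightedIntegral 1 ζ (P 1 ζ i * P 0 ζ (n + 1))) * hQ -
      z * ((P 1 ζ n).eval (-z) * (P 1 ζ i).eval z
        + (P 1 ζ n).eval z * (P 1 ζ i).eval (-z)) * hsqrt

theorem A1_mulVec_yZero (hζ : 0 < ζ) (n : ℕ) : (A1 ζ n).mulVec (yZero ζ n) = 0 := by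
  simp only [A1, yZero, Matrix.fromBlocks_mulVec, Sum.elim_comp_inl, Sum.elim_comp_inr,
    Matrix.zero_mulVec, Matrix.mulVec_zero, add_zero]
  ext (i | i)
  · rfl
  · simp only [Sum.elim_inr, Matrix.mulVec_smul, Matrix.mulVec_sub, Pi.sub_apply, Pi.smul_apply,
      smul_eq_mul, mixed_mulVec_Pvec hζ, Pi.zero_apply]
    ring

theorem eval_P_ne_zero (l : ℕ) (hζ : 0 < ζ) (n : ℕ) {x : ℝ} (hx : x ≤ 1) :
    (P l ζ n).eval x ≠ 0 := by
  rw [P, eval_mul, eval_C]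
  exact mul_ne_zero (inv_sqrt_ip_monicOP_pos l hζ n).ne'
    ((isMonicOrthogonal_monicOP l hζ).eval_ne_zero_of_le (isPositiveOn_weightedIntegral l hζ) n hx)

theorem exists_P_zero_eq_C (l : ℕ) (hζ : 0 < ζ) : ∃ c ≠ 0, P l ζ 0 = C c :=
  have hC := eq_C_of_natDegree_eq_zero (natDegree_P l hζ 0)
  ⟨_, fun h0 => (isOrthonormal_P l hζ).ne_zero 0 (by rw [hC, h0, C_0]), hC⟩

theorem yVec_ne_zero (hζ : 0 < ζ) (hn : 0 < n) {z : ℝ} (hz : 1 < z ^ 2) : yVec ζ n z ≠ 0 := by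
  intro h
  obtain ⟨c₀, hc₀, hP₀⟩ := exists_P_zero_eq_C 0 hζ
  obtain ⟨c₁, hc₁, hP₁⟩ := exists_P_zero_eq_C 1 hζ
  have hsqrt : √(z ^ 2 - 1) ≠ 0 := (Real.sqrt_pos.2 (by linarith)).ne'
  have hu : ((P 1 ζ n).eval (-z) + (P 1 ζ n).eval z) * c₀ = 0 := by
    simpa [yVec, uVec, Pvec, hP₀, add_mul] using congrFun h (Sum.inl 0)
  have hv : ((P 1 ζ n).eval (-z) - (P 1 ζ n).eval z) * c₁ = 0 := by
    simpa [yVec, vVec, Pvec, hP₁, sub_mul, hsqrt] using congrFun h (Sum.inr ⟨0, hn⟩)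
  have hsum := (mul_eq_zero.1 hu).resolve_right hc₀
  have hdiff := (mul_eq_zero.1 hv).resolve_right hc₁
  rcases le_total z 0 with hz0 | hz0
  · exact eval_P_ne_zero 1 hζ n (x := z) (by linarith) (by linarith)
  · exact eval_P_ne_zero 1 hζ n (x := -z) (by linarith) (by linarith)

theorem yZero_ne_zero (hζ : 0 < ζ) (n : ℕ) : yZero ζ n ≠ 0 := by
  intro h
  obtain ⟨c₀, hc₀, hP₀⟩ := exists_P_zero_eq_C 0 hζ
  have hu : ((P 0 ζ (n + 1)).eval (-1) - (P 0 ζ (n + 1)).eval 1) * c₀ = 0 := by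
    simpa [yZero, Pvec, hP₀, sub_mul] using congrFun h (Sum.inl 0)
  have heq : (P 0 ζ (n + 1)).eval (-1) = (P 0 ζ (n + 1)).eval 1 :=
    sub_eq_zero.1 ((mul_eq_zero.1 hu).resolve_right hc₀)
  simp only [P, eval_mul, eval_C] at heq
  have hlt := (isMonicOrthogonal_monicOP 0 hζ).abs_eval_lt_abs_eval
    (isPositiveOn_weightedIntegral 0 hζ) n.succ_pos (neg_one_lt_zero.trans one_pos) le_rfl
  exact hlt.ne' (congrArg abs (mul_left_cancel₀ (inv_sqrt_ip_monicOP_pos 0 hζ (n + 1)).ne' heq))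

end Eigenvectors

/-! ### The spectrum -/

section LamHat

variable {z w : ℝ}

theorem lamHat_neg (z : ℝ) : lamHat (-z) = -lamHat z := by
  rw [lamHat, lamHat, neg_sq, div_neg]

theorem lamHat_sq (hz : 1 < z ^ 2) : lamHat z ^ 2 = 1 - (z ^ 2)⁻¹ := by
  rw [lamHat, div_pow, Real.sq_sqrt (by linarith), sub_div, div_self (by positivity), one_div]

theorem lamHat_ne_zero (hz : 1 < z ^ 2) : lamHat z ≠ 0 :=
  div_ne_zero (Real.sqrt_pos.2 (by linarith)).ne' fun h0 => by norm_num [h0] at hz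

theorem abs_lamHat_lt_one (hz : 1 < z ^ 2) : |lamHat z| < 1 := by
  rw [← sq_lt_one_iff_abs_lt_one, lamHat_sq hz, sub_lt_self_iff]
  positivity

theorem lamHat_injOn : Set.InjOn lamHat {z | 1 < z ^ 2} := by
  intro z hz w hw h
  have hsq : z ^ 2 = w ^ 2 := by
    have := congrArg (· ^ 2) h
    simpa only [lamHat_sq hz, lamHat_sq hw, sub_right_inj, inv_inj] using this
  refine (sq_eq_sq_iff_eq_or_eq_neg.1 hsq).resolve_right fun hneg => lamHat_ne_zero hw ?_
  rw [hneg, lamHat_neg] at h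
  linarith

theorem hasDerivAt_lamHat (hz : 1 < z) :
    HasDerivAt lamHat (1 / (√(z ^ 2 - 1) * z ^ 2)) z := by
  have hsq : 0 < z ^ 2 - 1 := by nlinarith
  have hz0 : z ≠ 0 := by linarith
  have hderiv := (((hasDerivAt_pow 2 z).sub_const 1).sqrt hsq.ne').div (hasDerivAt_id' z) hz0
  refine hderiv.congr_deriv ?_
  field_simp
  rw [Real.sq_sqrt hsq.le]
  push_cast
  ring

end LamHat

section Spectrum

variable {ζ : ℝ} {n : ℕ}

theorem exists_hasDerivAt_lamHat_zeroAt_of_pos (hζ : 0 < ζ) {i : ℤ} (hi : i ∈ idx n)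
    (hpos : 0 < i) : ∃ d : ℝ, HasDerivAt (fun s => lamHat (zeroAt n i s)) d ζ ∧ d < 0 := by
  obtain ⟨k, rfl⟩ := exists_eq_succ_of_mem_idx hi hpos
  obtain ⟨d, hd, hzero⟩ := exists_hasDerivAt_posZero hζ k
  have hz := one_lt_posZero hζ k
  have hsqrt : 0 < √(posZero n ζ k ^ 2 - 1) := Real.sqrt_pos.2 (by nlinarith)
  have hcomp : HasDerivAt (fun s => lamHat (posZero n s k)) _ ζ :=
    HasDerivAt.comp (h₂ := lamHat) ζ (hasDerivAt_lamHat hz) hzero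
  simp only [zeroAt, oddExtend_succ]
  exact ⟨_, hcomp, mul_neg_of_pos_of_neg (by positivity) hd⟩

theorem exists_hasDerivAt_lamHat_zeroAt_of_neg (hζ : 0 < ζ) {i : ℤ} (hi : i ∈ idx n)
    (hneg : i < 0) : ∃ d : ℝ, HasDerivAt (fun s => lamHat (zeroAt n i s)) d ζ ∧ 0 < d := by
  obtain ⟨d, hd, hd0⟩ :=
    exists_hasDerivAt_lamHat_zeroAt_of_pos hζ (neg_mem_idx hi) (neg_pos.2 hneg)
  refine ⟨-d, ?_, neg_pos.2 hd0⟩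
  simpa only [zeroAt_neg, lamHat_neg, neg_neg] using hd.fun_neg

theorem lamHat_zeroAt_injOn (hζ : 0 < ζ) :
    Set.InjOn (fun i => lamHat (zeroAt n i ζ)) (idx n) :=
  lamHat_injOn.comp (zeroAt_strictMonoOn hζ).injOn fun _ hi => one_lt_sq_zeroAt hζ hi

/-- The numbers `λ̂_{0,n} = 0` and `λ̂_{i,n}`, `i ∈ idx n`. -/
noncomputable def spectrumSet (ζ : ℝ) (n : ℕ) : Finset ℝ :=
  insert 0 ((labels n).image fun i => lamHat (zeroAt n i ζ))

theorem mem_spectrumSet {μ : ℝ} :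
    μ ∈ spectrumSet ζ n ↔ μ = 0 ∨ ∃ i ∈ idx n, lamHat (zeroAt n i ζ) = μ := by
  simp only [spectrumSet, Finset.mem_insert, Finset.mem_image, mem_labels]

theorem zero_mem_spectrumSet (ζ : ℝ) (n : ℕ) : 0 ∈ spectrumSet ζ n :=
  Finset.mem_insert_self _ _

theorem lamHat_mem_spectrumSet {i : ℤ} (hi : i ∈ idx n) :
    lamHat (zeroAt n i ζ) ∈ spectrumSet ζ n :=
  mem_spectrumSet.2 (Or.inr ⟨i, hi, rfl⟩)

theorem card_spectrumSet (hζ : 0 < ζ) (n : ℕ) :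
    (spectrumSet ζ n).card = Fintype.card (Fin (n + 1) ⊕ Fin n) := by
  have hzero : 0 ∉ (labels n).image fun i => lamHat (zeroAt n i ζ) := fun h => by
    obtain ⟨i, hi, h0⟩ := Finset.mem_image.1 h
    exact lamHat_ne_zero (one_lt_sq_zeroAt hζ (mem_labels.1 hi)) h0
  have hinj : Set.InjOn (fun i => lamHat (zeroAt n i ζ)) (labels n) := fun i hi j hj =>
    lamHat_zeroAt_injOn hζ (mem_labels.1 hi) (mem_labels.1 hj)
  rw [spectrumSet, Finset.card_insert_of_notMem hzero, Finset.card_image_of_injOn hinj,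
    card_labels, Fintype.card_sum, Fintype.card_fin, Fintype.card_fin]
  omega

theorem yVec_zeroAt_ne_zero (hζ : 0 < ζ) {i : ℤ} (hi : i ∈ idx n) :
    yVec ζ n (zeroAt n i ζ) ≠ 0 :=
  yVec_ne_zero hζ (by exact_mod_cast (abs_pos.2 hi.1).trans_le hi.2) (one_lt_sq_zeroAt hζ hi)

theorem A1_mulVec_yVec_zeroAt (hζ : 0 < ζ) {i : ℤ} (hi : i ∈ idx n) :
    (A1 ζ n).mulVec (yVec ζ n (zeroAt n i ζ)) =
      lamHat (zeroAt n i ζ) • (A0 ζ n).mulVec (yVec ζ n (zeroAt n i ζ)) :=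
  A1_mulVec_yVec hζ (one_lt_sq_zeroAt hζ hi) ((isRoot_Q_iff hζ).2 ⟨i, hi, rfl⟩)

theorem isGenEigenvalue_of_mem_spectrumSet (hζ : 0 < ζ) {μ : ℝ} (hμ : μ ∈ spectrumSet ζ n) :
    IsGenEigenvalue (A0 ζ n) (A1 ζ n) μ := by
  rcases mem_spectrumSet.1 hμ with rfl | ⟨i, hi, rfl⟩
  · exact ⟨_, yZero_ne_zero hζ n, by rw [A1_mulVec_yZero hζ, zero_smul]⟩
  · exact ⟨_, yVec_zeroAt_ne_zero hζ hi, A1_mulVec_yVec_zeroAt hζ hi⟩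

theorem isGenEigenvalue_complex_iff (hζ : 0 < ζ) {μ : ℂ} :
    IsGenEigenvalue ((A0 ζ n).map Complex.ofReal) ((A1 ζ n).map Complex.ofReal) μ ↔
      μ = 0 ∨ ∃ i ∈ idx n, μ = (lamHat (zeroAt n i ζ) : ℂ) := by
  refine (isGenEigenvalue_map_iff Complex.ofRealHom (det_A0_ne_zero hζ n) (card_spectrumSet hζ n)
    fun _ => isGenEigenvalue_of_mem_spectrumSet hζ).trans ?_
  simp only [mem_spectrumSet, Complex.ofRealHom_eq_coe]
  constructor
  · rintro ⟨_, rfl | ⟨i, hi, rfl⟩, rfl⟩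
    · exact Or.inl Complex.ofReal_zero
    · exact Or.inr ⟨i, hi, rfl⟩
  · rintro (rfl | ⟨i, hi, rfl⟩)
    · exact ⟨0, Or.inl rfl, Complex.ofReal_zero⟩
    · exact ⟨_, Or.inr ⟨i, hi, rfl⟩, rfl⟩

theorem rootMultiplicity_pencilPoly_A0_A1 (hζ : 0 < ζ) {μ : ℝ} (hμ : μ ∈ spectrumSet ζ n) :
    (pencilPoly (A0 ζ n) (A1 ζ n)).rootMultiplicity μ = 1 :=
  rootMultiplicity_pencilPoly (det_A0_ne_zero hζ n) (card_spectrumSet hζ n)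
    (fun _ => isGenEigenvalue_of_mem_spectrumSet hζ) hμ

theorem A1_mulVec_eq_lamHat_smul_iff (hζ : 0 < ζ) {i : ℤ} (hi : i ∈ idx n)
    (y : Fin (n + 1) ⊕ Fin n → ℝ) :
    (A1 ζ n).mulVec y = lamHat (zeroAt n i ζ) • (A0 ζ n).mulVec y ↔
      ∃ c : ℝ, y = c • yVec ζ n (zeroAt n i ζ) :=
  mulVec_eq_smul_mulVec_iff (det_A0_ne_zero hζ n)
    (rootMultiplicity_pencilPoly_A0_A1 hζ (lamHat_mem_spectrumSet hi)) (yVec_zeroAt_ne_zero hζ hi)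
    (A1_mulVec_yVec_zeroAt hζ hi)

theorem A1_mulVec_eq_zero_smul_iff (hζ : 0 < ζ) (y : Fin (n + 1) ⊕ Fin n → ℝ) :
    (A1 ζ n).mulVec y = (0 : ℝ) • (A0 ζ n).mulVec y ↔ ∃ c : ℝ, y = c • yZero ζ n :=
  mulVec_eq_smul_mulVec_iff (det_A0_ne_zero hζ n)
    (rootMultiplicity_pencilPoly_A0_A1 hζ (zero_mem_spectrumSet ζ n)) (yZero_ne_zero hζ n)
    (by rw [A1_mulVec_yZero hζ, zero_smul])

end Spectrum

end RelOP

theorem mainTheorem3 (n : ℕ) :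
    ∃ z : ℤ → ℝ → ℝ, ∀ ζ : ℝ, 0 < ζ →
      -- `Q_{2n}` is even of degree `2n`; its zeros are the simple zeros `z_i`, `i = ±1, …, ±n`
      ((RelOP.Q ζ n).comp (-Polynomial.X) = RelOP.Q ζ n ∧
        (RelOP.Q ζ n).natDegree = 2 * n ∧
        (∀ x : ℝ, (RelOP.Q ζ n).IsRoot x ↔ ∃ i ∈ idx n, x = z i ζ) ∧
        (∀ i ∈ idx n, (RelOP.Q ζ n).rootMultiplicity (z i ζ) = 1) ∧
        (∀ i ∈ idx n, 0 < i → 1 < z i ζ) ∧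
        (∀ i ∈ idx n, z (-i) ζ = -z i ζ) ∧
        (∀ i ∈ idx n, ∀ j ∈ idx n, i < j → z i ζ < z j ζ)) ∧
      -- the generalized eigenvalues, real and complex, are `0` and the `2n` numbers `λ̂_i`
      (∀ μ : ℂ, IsGenEigenvalue ((A0 ζ n).map Complex.ofReal) ((A1 ζ n).map Complex.ofReal) μ ↔
        μ = 0 ∨ ∃ i ∈ idx n, μ = (lamHat (z i ζ) : ℂ)) ∧
      -- `0` and the `λ̂_i` are simple, the `λ̂_i` are nonzero, distinct, of modulus less than one
      (pencilPoly (A0 ζ n) (A1 ζ n)).rootMultiplicity 0 = 1 ∧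
      (∀ i ∈ idx n, (pencilPoly (A0 ζ n) (A1 ζ n)).rootMultiplicity (lamHat (z i ζ)) = 1) ∧
      (∀ i ∈ idx n, lamHat (z i ζ) ≠ 0 ∧ |lamHat (z i ζ)| < 1) ∧
      (∀ i ∈ idx n, ∀ j ∈ idx n, lamHat (z i ζ) = lamHat (z j ζ) → i = j) ∧
      -- dependence on `ζ`
      (∀ i ∈ idx n, 0 < i → ∃ d : ℝ, HasDerivAt (fun s => lamHat (z i s)) d ζ ∧ d < 0) ∧
      (∀ i ∈ idx n, i < 0 → ∃ d : ℝ, HasDerivAt (fun s => lamHat (z i s)) d ζ ∧ 0 < d) ∧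
      -- the eigenvectors, each unique up to a scalar factor
      (∀ i ∈ idx n, yVec ζ n (z i ζ) ≠ 0 ∧
        ∀ y : Fin (n + 1) ⊕ Fin n → ℝ,
          (A1 ζ n).mulVec y = lamHat (z i ζ) • (A0 ζ n).mulVec y ↔
            ∃ c : ℝ, y = c • yVec ζ n (z i ζ)) ∧
      (yZero ζ n ≠ 0 ∧
        ∀ y : Fin (n + 1) ⊕ Fin n → ℝ,
          (A1 ζ n).mulVec y = (0 : ℝ) • (A0 ζ n).mulVec y ↔ ∃ c : ℝ, y = c • yZero ζ n) := by
  refine ⟨zeroAt n, fun ζ hζ => ⟨⟨?_, ?_, ?_, ?_, ?_, ?_, ?_⟩, ?_, ?_, ?_, ?_, ?_, ?_, ?_, ?_, ?_⟩⟩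
  · exact Q_comp_neg_X ζ n
  · exact natDegree_Q hζ n
  · exact fun x => isRoot_Q_iff hζ
  · exact fun i hi => rootMultiplicity_Q hζ hi
  · exact fun i hi hpos => one_lt_zeroAt hζ hi hpos
  · exact fun i _ => zeroAt_neg n i ζ
  · exact fun i hi j hj hij => zeroAt_strictMonoOn hζ hi hj hij
  · exact fun μ => isGenEigenvalue_complex_iff hζ
  · exact rootMultiplicity_pencilPoly_A0_A1 hζ (zero_mem_spectrumSet ζ n)
  · exact fun i hi => rootMultiplicity_pencilPoly_A0_A1 hζ (lamHat_mem_spectrumSet hi)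
  · exact fun i hi => ⟨lamHat_ne_zero (one_lt_sq_zeroAt hζ hi),
      abs_lamHat_lt_one (one_lt_sq_zeroAt hζ hi)⟩
  · exact fun i hi j hj h => lamHat_zeroAt_injOn hζ hi hj h
  · exact fun i hi hpos => exists_hasDerivAt_lamHat_zeroAt_of_pos hζ hi hpos
  · exact fun i hi hneg => exists_hasDerivAt_lamHat_zeroAt_of_neg hζ hi hneg
  · exact fun i hi => ⟨yVec_zeroAt_ne_zero hζ hi, A1_mulVec_eq_lamHat_smul_iff hζ hi⟩
  · exact ⟨yZero_ne_zero hζ n, A1_mulVec_eq_zero_smul_iff hζ⟩
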